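/- Let $\alpha\in(0,1)$, $T>0$, $d\ge 1$, let $G\subset\mathbb{R}^d$ be a bounded open set (for instance a bounded Lipschitz domain), and let $G_0\subset G$ be a measurable subset of positive Lebesgue measure. Let $\xi$ be a real random variable on a probability space $(\Omega,\mathcal{F},\mathbb{P})$. Let $E_{\alpha,\beta}(z)=\sum_{n\ge 0} z^n/\Gamma(\alpha n+\beta)$ be the Mittag--Leffler function, and let $$\varphi^{(\xi)}_{\alpha,\alpha}(s)=\mathbb{E}\big(E_{\alpha,\alpha}(\mathrm{i}s\xi)\big),\qquad s\in\mathbb{R},$$ be the fractional characteristic function of $\xi$. For $y_0\in L^2(G)=L^2(G;\mathbb{C})$ and a control $u\in L^\infty((0,T)\times G_0;\mathbb{C})$ consider the system $$\partial^{\alpha}_{0,t}y-\mathrm{i}\,\xi\,\Delta y=\mathbf{1}_{G_0}u \ \text{ in } (0,T)\times G,\qquad y=0 \ \text{ on } (0,T)\times\partial G,\qquad y(0,\cdot)=y_0 \ \text{ in } G,$$ where $\partial^\alpha_{0,t}$ is the Caputo derivative of order $\alpha$. For a fixed real value of $\xi$, a weak solution is a function $y\in C([0,T];L^2(G))\cap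 L^1(0,T;H^1_0(G))$ with $y(0)=y_0$ such that, for every $v\in H^1_0(G)$, $$\partial^\alpha_{0,t}\langle y(t),v\rangle_{L^2(G)}+\mathrm{i}\,\xi\,\langle\nabla y(t),\nabla v\rangle_{L^2(G)}=\langle\mathbf{1}_{G_0}u(t,\cdot),v\rangle_{L^2(G)}\quad\text{on }(0,T);$$ here, for a continuous $f$ and an integrable $g$, $\partial^\alpha_{0,t}f=g$ on $(0,T)$ means that $$\frac{1}{\Gamma(1-\alpha)}\int_0^t (t-s)^{-\alpha}(f(s)-f(0))\,\mathrm{d}s=\int_0^t g(s)\,\mathrm{d}s\quad\text{for all }t\in[0,T].$$ Write $y(t;\xi;y_0;u)$ for the weak solution. The system is \emph{exactly averaged controllable} in $L^2(G)$ with controls in $L^\infty((0,T)\times G_0)$ if there is a constant $C>0$ such that for all $y_0,y_1\in L^2(G)$ there is a control $u\in L^\infty((0,T)\times G_0)$, independent of $\omega$, with $$\|u\|_{L^\infty((0,T)\times G_0)}\le C\big(\|y_0\|_{L^2(G)}+\|y_1\|_{L^2(G)}\big)\quad\text{and}\quad \mathbb{E}\big(y(T;\xi;y_0;u)\big)=y_1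 .$$ If $\varphi^{(\xi)}_{\alpha,\alpha}(s)\to 0$ as $|s|\to\infty$, then the system is not exactly averaged controllable in $L^2(G)$ with controls in $L^\infty((0,T)\times G_0)$, for any $T>0$. -/

import Mathlib

open MeasureTheory Filter Topology Set
open scoped ENNReal

noncomputable section

/-- The two-parameter Mittag-Leffler function `E_{α,β}(z) = ∑ zⁿ / Γ(α n + β)`. -/
def mittagLeffler (α β : ℝ) (z : ℂ) : ℂ :=
  ∑' n : ℕ, z ^ n / (Real.Gamma (α * n + β) : ℂ)

/-- The two-parameter fractional characteristic function
`φ_{α,β}^{(ξ)}(s) = 𝔼 (E_{α,β}(i s ξ))` of a real random variable `ξ`. -/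
def fracCharFun {Ω : Type*} [MeasurableSpace Ω] (P : Measure Ω) (ξ : Ω → ℝ)
    (α β : ℝ) (s : ℝ) : ℂ :=
  ∫ ω, mittagLeffler α β (Complex.I * s * ξ ω) ∂P

/-- The left Riemann-Liouville fractional integral
`(I^α_{0,t} f)(t) = (1 / Γ(α)) ∫₀ᵗ (t - s)^(α - 1) f(s) ds`. -/
def rlIntegral (α : ℝ) (f : ℝ → ℂ) (t : ℝ) : ℂ :=
  ((Real.Gamma α)⁻¹ : ℝ) * ∫ s in (0 : ℝ)..t, (((t - s) ^ (α - 1) : ℝ) : ℂ) * f s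

/-- The integrable function `g` is the Caputo derivative `∂^α_{0,t} f` (order `α ∈ (0,1)`) of the
continuous function `f` on `(0,T)`: `I^{1-α}_{0,t}(f - f(0))` is absolutely continuous on `[0,T]`,
vanishes at `0`, and has derivative `g`. If `f` is absolutely continuous, then
`I¹ (I^{1-α} f') = I^{1-α} (I¹ f') = I^{1-α} (f - f(0))`, so that this says
`g = I^{1-α}_{0,t} f'` almost everywhere. -/
def IsCaputoDeriv (α T : ℝ) (f g : ℝ → ℂ) : Prop :=
  ContinuousOn f (Icc 0 T) ∧ IntegrableOn g (Ioo 0 T) ∧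
    ∀ t ∈ Icc 0 T, rlIntegral (1 - α) (fun s => f s - f 0) t = ∫ s in (0 : ℝ)..t, g s

/-- The Hilbert space `L²(G; ℂ)`. -/
abbrev L2 {d : ℕ} (G : Set (EuclideanSpace ℝ (Fin d))) : Type :=
  Lp ℂ 2 (volume.restrict G)

/-- The Hilbert space `L²(G; ℂᵈ)`. -/
abbrev L2Vec {d : ℕ} (G : Set (EuclideanSpace ℝ (Fin d))) : Type :=
  Lp (EuclideanSpace ℂ (Fin d)) 2 (volume.restrict G)

/-- The classical gradient of a complex-valued function on `ℝᵈ`. -/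
def cgrad {d : ℕ} (φ : EuclideanSpace ℝ (Fin d) → ℂ) (x : EuclideanSpace ℝ (Fin d)) :
    EuclideanSpace ℂ (Fin d) :=
  WithLp.toLp 2 fun i => fderiv ℝ φ x (EuclideanSpace.single i 1)

/-- Test functions: `φ ∈ C_c^∞(G; ℂ)`. -/
def IsTestFunction {d : ℕ} (G : Set (EuclideanSpace ℝ (Fin d)))
    (φ : EuclideanSpace ℝ (Fin d) → ℂ) : Prop :=
  ContDiff ℝ ((⊤ : ℕ∞) : WithTop ℕ∞) φ ∧ HasCompactSupport φ ∧ tsupport φ ⊆ G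

/-- The Sobolev space `H¹₀(G)`, the closure of `C_c^∞(G)` for the norm
`‖f‖² = ‖f‖²_{L²} + ‖∇f‖²_{L²}`. An element is stored as the pair `(f, ∇f)`, that is, `H¹₀(G)` is
the closure of `{(φ, ∇φ) : φ ∈ C_c^∞(G)}` in `L²(G) × L²(G)ᵈ`; the second component is the weak
gradient of the first one and hence determined by it. -/
def H10 {d : ℕ} (G : Set (EuclideanSpace ℝ (Fin d))) :
    Submodule ℂ (WithLp 2 (L2 G × L2Vec G)) :=
  (Submodule.span ℂ {p : WithLp 2 (L2 G × L2Vec G) | ∃ φ, IsTestFunction G φ ∧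
    p.fst =ᵐ[volume.restrict G] φ ∧ p.snd =ᵐ[volume.restrict G] cgrad φ}).topologicalClosure

/-- The space of controls `L^∞((0,T) × G₀; ℂ)`. -/
abbrev Control {d : ℕ} (T : ℝ) (G₀ : Set (EuclideanSpace ℝ (Fin d))) : Type :=
  Lp ℂ ∞ ((volume.restrict (Ioo 0 T)).prod (volume.restrict G₀))

/-- `y` is the weak solution of
`∂^α_{0,t} y - ξ i Δ y = 1_{G₀} u` in `(0,T) × G`, `y = 0` on `(0,T) × ∂G`, `y(0,·) = y₀`:
`y ∈ C([0,T]; L²(G)) ∩ L¹(0,T; H¹₀(G))`, `y(0) = y₀`, and for every `v ∈ H¹₀(G)`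
`∂^α_{0,t} ⟨y(t), v⟩ + i ξ ⟨∇y(t), ∇v⟩ = ⟨1_{G₀} u(t,·), v⟩` on `(0,T)`.
(Mathlib's `inner ℂ v w` is linear in `w`.) -/
def IsWeakSolution {d : ℕ} (α T : ℝ) (G G₀ : Set (EuclideanSpace ℝ (Fin d))) (ξ : ℝ)
    (y₀ : L2 G) (u : Control T G₀) (y : ℝ → L2 G) : Prop :=
  ContinuousOn y (Icc 0 T) ∧ y 0 = y₀ ∧
    ∃ Y : ℝ → H10 G, IntegrableOn Y (Ioo 0 T) ∧
      (∀ᵐ t ∂(volume.restrict (Ioo 0 T)), (Y t : WithLp 2 (L2 G × L2Vec G)).fst = y t) ∧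
      ∀ v ∈ H10 G, IsCaputoDeriv α T
        (fun t => inner ℂ v.fst (y t))
        (fun t => -(Complex.I * ξ * inner ℂ v.snd (Y t : WithLp 2 (L2 G × L2Vec G)).snd) +
          ∫ x in G, starRingEnd ℂ (v.fst x) * G₀.indicator (fun x => u (t, x)) x)

/-- Exact averaged controllability in `L²(G)` with controls in `L^∞((0,T) × G₀)`: there is a control
cost `C > 0` such that for all `y₀, y₁ ∈ L²(G)` there is a control `u`, not depending on `ω`, with
`‖u‖_{L^∞} ≤ C (‖y₀‖ + ‖y₁‖)` for which the solutions `y(·; ξ(ω); y₀; u)` satisfy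
`𝔼 (y(T; ξ; y₀; u)) = y₁`. -/
def IsExactlyAveragedControllable {Ω : Type*} [MeasurableSpace Ω] (P : Measure Ω) (ξ : Ω → ℝ)
    {d : ℕ} (α T : ℝ) (G G₀ : Set (EuclideanSpace ℝ (Fin d))) : Prop :=
  ∃ C : ℝ, 0 < C ∧ ∀ y₀ y₁ : L2 G, ∃ u : Control T G₀, ‖u‖ ≤ C * (‖y₀‖ + ‖y₁‖) ∧
    ∃ y : Ω → ℝ → L2 G, (∀ᵐ ω ∂P, IsWeakSolution α T G G₀ (ξ ω) y₀ u (y ω)) ∧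
      Integrable (fun ω => y ω T) P ∧ ∫ ω, y ω T ∂P = y₁

end

theorem multichoose_real_succ (s : ℝ) (n : ℕ) :
    Ring.multichoose s (n + 1) = Ring.multichoose s n * ((s + n) / (n + 1)) := by
  have h1 := Ring.factorial_nsmul_multichoose_eq_ascPochhammer s n
  have h2 := Ring.factorial_nsmul_multichoose_eq_ascPochhammer s (n + 1)
  rw [Polynomial.ascPochhammer_smeval_eq_eval] at h1 h2
  rw [ascPochhammer_succ_eval, ← h1, Nat.factorial_succ] at h2
  simp only [nsmul_eq_mul, Nat.cast_mul, Nat.cast_add, Nat.cast_one] at h2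
  have h3 : (n.factorial : ℝ) ≠ 0 := by positivity
  have h4 : (n : ℝ) + 1 ≠ 0 := by positivity
  field_simp
  apply mul_left_cancel₀ h3
  linear_combination h2

theorem multichoose_real_nonneg {s : ℝ} (hs : 0 ≤ s) (n : ℕ) : 0 ≤ Ring.multichoose s n := by
  induction n with
  | zero => simp
  | succ n ih => rw [multichoose_real_succ]; positivity

theorem multichoose_neg_nonpos {α : ℝ} (h0 : 0 ≤ α) (h1 : α ≤ 1) (n : ℕ) :
    Ring.multichoose (-α) (n + 1) ≤ 0 := by
  induction n with
  | zero => simp [h0]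
  | succ n ih =>
    rw [multichoose_real_succ]
    refine mul_nonpos_of_nonpos_of_nonneg ih (div_nonneg ?_ (by positivity))
    push_cast
    have : (0 : ℝ) ≤ n := by positivity
    linarith

theorem multichoose_real_le {s : ℝ} (hs : 0 ≤ s) (n : ℕ) : Ring.multichoose s n ≤ (s + n) ^ n := by
  induction n with
  | zero => simp
  | succ n ih =>
    have hn : (0 : ℝ) ≤ n := by positivity
    rw [multichoose_real_succ, pow_succ]
    push_cast
    have h1 : (s + n) / (n + 1) ≤ s + n := div_le_self (by positivity) (by linarith)
    calc Ring.multichoose s n * ((s + n) / (n + 1)) ≤ (s + n) ^ n * (s + n) := by gcongr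
      _ ≤ (s + (n + 1)) ^ n * (s + (n + 1)) := by gcongr <;> linarith

theorem multichoose_real_succ_left (s : ℝ) (n : ℕ) :
    Ring.multichoose (s + 1) n * s = Ring.multichoose s n * (s + n) := by
  induction n with
  | zero => simp
  | succ n ih =>
    rw [multichoose_real_succ, multichoose_real_succ]
    push_cast
    have h4 : (n : ℝ) + 1 ≠ 0 := by positivity
    field_simp
    linear_combination (s + 1 + n) * ih

theorem multichoose_real_add (s t : ℝ) (n : ℕ) :
    Ring.multichoose (s + t) n =
      ∑ ij ∈ Finset.HasAntidiagonal.antidiagonal n, Ring.multichoose s ij.1 * Ring.multichoose t ij.2 := by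
  have key (r : ℝ) (m : ℕ) : Ring.multichoose r m = (-1) ^ m * Ring.choose (-r) m := by
    rw [Ring.choose_neg', Int.negOnePow_def]
    simp [Units.smul_def, ← mul_assoc, ← mul_pow]
  rw [key, neg_add, Ring.add_choose_eq n (Commute.all _ _), Finset.mul_sum]
  refine Finset.sum_congr rfl fun ij hij => ?_
  rw [key s, key t, ← Finset.HasAntidiagonal.mem_antidiagonal.1 hij, pow_add]
  ring

theorem tendsto_rpow_mul_multichoose {s : ℝ} (hs : 0 < s) :
    Tendsto (fun n : ℕ => (n : ℝ) ^ (1 - s) * Ring.multichoose s n) atTop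
      (𝓝 (Real.Gamma s)⁻¹) := by
  have h1 := (Real.GammaSeq_tendsto_Gamma s).inv₀ (Real.Gamma_pos_of_pos hs).ne'
  have h2 : Tendsto (fun n : ℕ => (n : ℝ) / (n + s)) atTop (𝓝 1) :=
    tendsto_natCast_div_add_atTop s
  have h3 := h1.mul h2
  rw [mul_one] at h3
  refine h3.congr' ?_
  filter_upwards [eventually_gt_atTop 0] with n hn
  have hn' : (0 : ℝ) < n := by exact_mod_cast hn
  have hp (m : ℕ) : ∏ j ∈ Finset.range m, (s + j) = Ring.multichoose s m * m.factorial := by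
    induction m with
    | zero => simp
    | succ m ih =>
      rw [Finset.prod_range_succ, ih, multichoose_real_succ, Nat.factorial_succ]
      push_cast
      have h4 : (m : ℝ) + 1 ≠ 0 := by positivity
      field_simp
  rw [Real.GammaSeq, Finset.prod_range_succ, hp, Real.rpow_sub hn', Real.rpow_one]
  have h5 : (n.factorial : ℝ) ≠ 0 := by positivity
  have h6 : (n : ℝ) ^ s ≠ 0 := by positivity
  have h7 : s + n ≠ 0 := by positivity
  rw [add_comm (n : ℝ) s]
  field_simp

theorem rpow_mul_multichoose_antitone {s : ℝ} (hs : 1 ≤ s) {m n : ℕ} (hm : 0 < m) (hmn : m ≤ n) :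
    (n : ℝ) ^ (1 - s) * Ring.multichoose s n ≤ (m : ℝ) ^ (1 - s) * Ring.multichoose s m := by
  induction n, hmn using Nat.le_induction with
  | base => rfl
  | succ n hmn ih =>
    refine le_trans ?_ ih
    have hn : (0 : ℝ) < n := by exact_mod_cast hm.trans_le hmn
    have hc := multichoose_real_nonneg (zero_le_one.trans hs) n
    rw [multichoose_real_succ]
    push_cast
    have hn1 : (0 : ℝ) < 1 / n := by positivity
    have hb := one_add_mul_self_le_rpow_one_add (s := 1 / (n : ℝ)) (by linarith) hs
    have e : 1 + 1 / (n : ℝ) = (n + 1) / n := by field_simp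
    rw [e, Real.div_rpow (by positivity) hn.le, le_div_iff₀ (by positivity)] at hb
    rw [Real.rpow_sub hn, Real.rpow_sub (by positivity), Real.rpow_one, Real.rpow_one]
    have h6 : 0 < (n : ℝ) ^ s := by positivity
    have h7 : 0 < ((n : ℝ) + 1) ^ s := by positivity
    have h8 : (s + n) * (n : ℝ) ^ s ≤ n * ((n : ℝ) + 1) ^ s := by
      have := mul_le_mul_of_nonneg_left hb hn.le
      calc _ = (n : ℝ) * ((1 + s * (1 / n)) * (n : ℝ) ^ s) := by field_simp; ring
        _ ≤ _ := this
    have e1 : ((n : ℝ) + 1) / (n + 1) ^ s * (Ring.multichoose s n * ((s + n) / (n + 1)))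
      = Ring.multichoose s n * ((s + n) / (n + 1) ^ s) := by field_simp
    have e2 : (n : ℝ) / n ^ s * Ring.multichoose s n = Ring.multichoose s n * (n / n ^ s) := by ring
    rw [e1, e2]
    refine mul_le_mul_of_nonneg_left ?_ hc
    rw [div_le_div_iff₀ h7 h6]
    exact h8

theorem rpow_mul_multichoose_le {s : ℝ} (hs : 0 < s) {m n : ℕ} (hm : 0 < m) (hmn : m ≤ n) :
    (n : ℝ) ^ (1 - s) * Ring.multichoose s n ≤
      s * ((m : ℝ) ^ (-s) * Ring.multichoose (s + 1) m) := by
  have h := rpow_mul_multichoose_antitone (s := s + 1) (by linarith) hm hmn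
  have hn : (0 : ℝ) < n := by exact_mod_cast hm.trans_le hmn
  have e : 1 - (s + 1) = -s := by ring
  rw [e] at h
  refine le_trans ?_ (mul_le_mul_of_nonneg_left h hs.le)
  have h1 := multichoose_real_succ_left s n
  have hc := multichoose_real_nonneg hs.le n
  rw [show s * ((n : ℝ) ^ (-s) * Ring.multichoose (s + 1) n) =
    (n : ℝ) ^ (-s) * (Ring.multichoose (s + 1) n * s) by ring, h1, sub_eq_add_neg, Real.rpow_add hn,
    Real.rpow_one]
  have h2 : 0 ≤ (n : ℝ) ^ (-s) * Ring.multichoose s n := by positivity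
  nlinarith

theorem summable_pow_mul_multichoose {α r : ℝ} (hα : 0 ≤ α) (h0 : 0 ≤ r) (h1 : r < 1) (b : ℝ)
    (hb : 0 ≤ b) (n : ℕ) :
    Summable fun k : ℕ => r ^ k * Ring.multichoose (α * k + b) n := by
  have h := (summable_nat_add_iff 1).2
    (summable_pow_mul_geometric_of_norm_lt_one (R := ℝ) n (r := max r 2⁻¹)
      (by rw [Real.norm_of_nonneg (by positivity)]; exact max_lt h1 (by norm_num)))
  refine Summable.of_nonneg_of_le (fun k => ?_) (fun k => ?_)
    (h.mul_left ((max r 2⁻¹)⁻¹ * (α + b + n) ^ n))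
  · exact mul_nonneg (by positivity) (multichoose_real_nonneg (by positivity) n)
  · have hm : 0 < max r 2⁻¹ := lt_max_of_lt_right (by norm_num)
    have h2 : Ring.multichoose (α * k + b) n ≤ ((α + b + n) * (k + 1)) ^ n := by
      refine (multichoose_real_le (by positivity) n).trans ?_
      gcongr
      have : (0 : ℝ) ≤ k := by positivity
      have : (0 : ℝ) ≤ n := by positivity
      nlinarith [mul_nonneg hb (Nat.cast_nonneg (α := ℝ) k), mul_nonneg this (Nat.cast_nonneg (α := ℝ) k)]
    calc r ^ k * Ring.multichoose (α * k + b) n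
        ≤ (max r 2⁻¹) ^ k * ((α + b + n) * (k + 1)) ^ n := by
          gcongr
          · exact multichoose_real_nonneg (by positivity) n
          · exact le_max_left _ _
      _ = _ := by
          push_cast
          rw [mul_pow, pow_succ]
          field_simp

/-- The coefficient of `xⁿ` in `1 / ((1 - x)^α - w)`, expanded in powers of `w`. -/
noncomputable def fracResolventCoeff (α : ℝ) (w : ℂ) (n : ℕ) : ℂ :=
  ∑' k : ℕ, w ^ k * (Ring.multichoose (α * k + α) n : ℝ)

theorem summable_fracResolventCoeff {α : ℝ} (hα : 0 ≤ α) {w : ℂ} (hw : ‖w‖ < 1) {b : ℝ}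
    (hb : 0 ≤ b) (n : ℕ) :
    Summable fun k : ℕ => w ^ k * ((Ring.multichoose (α * k + b) n : ℝ) : ℂ) := by
  refine Summable.of_norm ((summable_pow_mul_multichoose hα (norm_nonneg w) hw b hb n).congr
    fun k => ?_)
  rw [norm_mul, norm_pow, Complex.norm_real,
    Real.norm_of_nonneg (multichoose_real_nonneg (by positivity) n)]

theorem sum_antidiagonal_multichoose_mul_fracResolventCoeff {α : ℝ} (hα : 0 ≤ α) {w : ℂ}
    (hw : ‖w‖ < 1) (n : ℕ) :
    ∑ ij ∈ Finset.HasAntidiagonal.antidiagonal n,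
        ((Ring.multichoose (-α) ij.1 : ℝ) : ℂ) * fracResolventCoeff α w ij.2 =
      w * fracResolventCoeff α w n + ((Ring.multichoose (0 : ℝ) n : ℝ) : ℂ) := by
  have h1 : ∑ ij ∈ Finset.HasAntidiagonal.antidiagonal n,
        ((Ring.multichoose (-α) ij.1 : ℝ) : ℂ) * fracResolventCoeff α w ij.2 =
      ∑' k : ℕ, w ^ k * ((Ring.multichoose (α * k + 0) n : ℝ) : ℂ) := by
    have hs (ij : ℕ × ℕ) : Summable fun k : ℕ => ((Ring.multichoose (-α) ij.1 : ℝ) : ℂ) *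
        (w ^ k * ((Ring.multichoose (α * k + α) ij.2 : ℝ) : ℂ)) :=
      (summable_fracResolventCoeff hα hw hα ij.2).mul_left _
    simp only [fracResolventCoeff, ← tsum_mul_left]
    rw [← Summable.tsum_finsetSum fun ij _ => hs ij]
    refine tsum_congr fun k => ?_
    rw [show α * k + 0 = -α + (α * k + α) by ring, multichoose_real_add, Complex.ofReal_sum,
      Finset.mul_sum]
    refine Finset.sum_congr rfl fun ij _ => ?_
    push_cast
    ring
  rw [h1, (summable_fracResolventCoeff hα hw le_rfl n).tsum_eq_zero_add, fracResolventCoeff,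
    ← tsum_mul_left, add_comm]
  congr 1
  · refine tsum_congr fun k => ?_
    push_cast
    rw [pow_succ, mul_add, mul_one, add_zero]
    ring
  · simp

theorem norm_fracResolventCoeff_le {α : ℝ} (h0 : 0 ≤ α) (h1 : α ≤ 1) {w : ℂ} (hw : ‖w‖ < 1)
    (hre : w.re ≤ 0) (n : ℕ) :
    ‖fracResolventCoeff α w n‖ ≤ Ring.multichoose α n := by
  induction n using Nat.strong_induction_on with
  | _ n ih =>
    have hA := sum_antidiagonal_multichoose_mul_fracResolventCoeff h0 hw n
    have hB := multichoose_real_add (-α) α n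
    rw [neg_add_cancel] at hB
    rw [Finset.Nat.sum_antidiagonal_eq_sum_range_succ_mk, Finset.sum_range_succ'] at hA hB
    simp only [Ring.multichoose_zero_right, Complex.ofReal_one,
      one_mul, Nat.sub_zero] at hA hB
    have hw1 : 1 ≤ ‖1 - w‖ := by
      refine le_trans ?_ (Complex.re_le_norm _)
      simp
      exact hre
    have hz : 0 ≤ Ring.multichoose (0 : ℝ) n := multichoose_real_nonneg le_rfl n
    have hC : (1 - w) * fracResolventCoeff α w n = ((Ring.multichoose (0 : ℝ) n : ℝ) : ℂ) +
        ∑ k ∈ Finset.range n, (((-Ring.multichoose (-α) (k + 1) : ℝ)) : ℂ) *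
          fracResolventCoeff α w (n - (k + 1)) := by
      simp only [Complex.ofReal_neg, neg_mul, Finset.sum_neg_distrib]
      linear_combination hA
    calc ‖fracResolventCoeff α w n‖ ≤ ‖1 - w‖ * ‖fracResolventCoeff α w n‖ :=
          le_mul_of_one_le_left (norm_nonneg _) hw1
      _ = ‖((Ring.multichoose (0 : ℝ) n : ℝ) : ℂ) +
        ∑ k ∈ Finset.range n, (((-Ring.multichoose (-α) (k + 1) : ℝ)) : ℂ) *
          fracResolventCoeff α w (n - (k + 1))‖ := by rw [← norm_mul, hC]
      _ ≤ Ring.multichoose (0 : ℝ) n + ∑ k ∈ Finset.range n,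
          -Ring.multichoose (-α) (k + 1) * Ring.multichoose α (n - (k + 1)) := by
        refine (norm_add_le _ _).trans (add_le_add ?_ ?_)
        · rw [Complex.norm_real, Real.norm_of_nonneg hz]
        · refine norm_sum_le_of_le _ fun k hk => ?_
          have hp : 0 ≤ -Ring.multichoose (-α) (k + 1) :=
            neg_nonneg.2 (multichoose_neg_nonpos h0 h1 k)
          rw [norm_mul, Complex.norm_real, Real.norm_of_nonneg hp]
          refine mul_le_mul_of_nonneg_left (ih _ ?_) hp
          have := Finset.mem_range.1 hk
          omega
      _ = Ring.multichoose α n := by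
        simp only [neg_mul, Finset.sum_neg_distrib]
        linarith

theorem exists_summable_bound_mittagLeffler {α : ℝ} (hα : 0 < α) (z : ℂ) :
    ∃ bound : ℕ → ℝ, Summable bound ∧ ∀ᶠ n : ℕ in atTop, ∀ k : ℕ,
      ‖z ^ k * (((n : ℝ) ^ (1 - (α * k + α)) * Ring.multichoose (α * k + α) n : ℝ) : ℂ)‖
        ≤ bound k := by
  have h1 : Tendsto (fun n : ℕ => ‖z‖ * (n : ℝ) ^ (-α)) atTop (𝓝 (‖z‖ * 0)) :=
    ((tendsto_rpow_neg_atTop hα).comp tendsto_natCast_atTop_atTop).const_mul _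
  rw [mul_zero] at h1
  obtain ⟨m, hm, hm0⟩ := ((h1.eventually_lt_const zero_lt_one).and
    (eventually_gt_atTop 0)).exists
  have hm' : (0 : ℝ) < m := by exact_mod_cast hm0
  set r := ‖z‖ * (m : ℝ) ^ (-α) with hr
  have hr0 : 0 ≤ r := by positivity
  have hS := (summable_pow_mul_multichoose (b := α) hα.le hr0 hm hα.le (m + 1)).mul_left
    ((m : ℝ) ^ (-α) * (m + 1))
  refine ⟨_, hS, ?_⟩
  filter_upwards [eventually_ge_atTop m] with n hn k
  have hs : 0 < α * k + α := by positivity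
  rw [norm_mul, norm_pow, Complex.norm_real, Real.norm_of_nonneg
    (mul_nonneg (by positivity) (multichoose_real_nonneg hs.le n))]
  refine (mul_le_mul_of_nonneg_left (rpow_mul_multichoose_le hs hm0 hn)
    (by positivity)).trans (le_of_eq ?_)
  have e1 := multichoose_real_succ_left (α * k + α) m
  have e2 := multichoose_real_succ (α * k + α) m
  have e3 : Ring.multichoose (α * k + α + 1) m * (α * k + α) =
      Ring.multichoose (α * k + α) (m + 1) * (m + 1) := by
    rw [e1, e2]; field_simp
  have e4 : (m : ℝ) ^ (-(α * k + α)) = ((m : ℝ) ^ (-α)) ^ k * (m : ℝ) ^ (-α) := by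
    rw [← Real.rpow_natCast, ← Real.rpow_mul hm'.le, ← Real.rpow_add hm']
    congr 1; ring
  rw [e4, hr, mul_pow]
  linear_combination (‖z‖ ^ k * (((m : ℝ) ^ (-α)) ^ k * (m : ℝ) ^ (-α))) * e3

theorem tendsto_mittagLeffler_summand {α : ℝ} (hα : 0 < α) (z : ℂ) (k : ℕ) :
    Tendsto (fun n : ℕ =>
      z ^ k * (((n : ℝ) ^ (1 - (α * k + α)) * Ring.multichoose (α * k + α) n : ℝ) : ℂ)) atTop
      (𝓝 (z ^ k / (Real.Gamma (α * k + α) : ℂ))) := by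
  rw [div_eq_mul_inv, ← Complex.ofReal_inv]
  exact (((Complex.continuous_ofReal.tendsto _).comp
    (tendsto_rpow_mul_multichoose (by positivity))).const_mul _)

theorem summable_norm_mittagLeffler {α : ℝ} (hα : 0 < α) (z : ℂ) :
    Summable fun k : ℕ => ‖z ^ k / (Real.Gamma (α * k + α) : ℂ)‖ := by
  obtain ⟨bound, hb, h⟩ := exists_summable_bound_mittagLeffler hα z
  refine Summable.of_nonneg_of_le (fun k => norm_nonneg _) (fun k => ?_) hb
  exact le_of_tendsto (tendsto_mittagLeffler_summand hα z k).norm (h.mono fun n hn => hn k)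

theorem hasSum_mittagLeffler {α : ℝ} (hα : 0 < α) (z : ℂ) :
    HasSum (fun k : ℕ => z ^ k / (Real.Gamma (α * k + α) : ℂ)) (mittagLeffler α α z) :=
  (summable_norm_mittagLeffler hα z).of_norm.hasSum

theorem measurable_mittagLeffler {α : ℝ} (hα : 0 < α) : Measurable (mittagLeffler α α) := by
  refine measurable_of_tendsto_metrizable (f := fun (n : ℕ) (z : ℂ) =>
    ∑ k ∈ Finset.range n, z ^ k / (Real.Gamma (α * k + α) : ℂ)) (fun n => by fun_prop) ?_
  rw [tendsto_pi_nhds]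
  exact fun z => (hasSum_mittagLeffler hα z).tendsto_sum_nat

/-- On the closed left half plane `E_{α,α}` is bounded by its value at the origin. -/
theorem norm_mittagLeffler_le {α : ℝ} (h0 : 0 < α) (h1 : α ≤ 1) {z : ℂ} (hz : z.re ≤ 0) :
    ‖mittagLeffler α α z‖ ≤ (Real.Gamma α)⁻¹ := by
  obtain ⟨bound, hb, h⟩ := exists_summable_bound_mittagLeffler h0 z
  have hlim := tendsto_tsum_of_dominated_convergence hb (tendsto_mittagLeffler_summand h0 z) h
  refine le_of_tendsto_of_tendsto hlim.norm (tendsto_rpow_mul_multichoose h0) ?_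
  have h2 : Tendsto (fun n : ℕ => ‖z‖ * (n : ℝ) ^ (-α)) atTop (𝓝 (‖z‖ * 0)) :=
    ((tendsto_rpow_neg_atTop h0).comp tendsto_natCast_atTop_atTop).const_mul _
  rw [mul_zero] at h2
  filter_upwards [h2.eventually_lt_const zero_lt_one, eventually_gt_atTop 0] with n hn hn0
  have hn' : (0 : ℝ) < n := by exact_mod_cast hn0
  have hp : 0 ≤ (n : ℝ) ^ (-α) := by positivity
  have e : ∑' k : ℕ,
      z ^ k * (((n : ℝ) ^ (1 - (α * k + α)) * Ring.multichoose (α * k + α) n : ℝ) : ℂ) =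
      (((n : ℝ) ^ (1 - α) : ℝ) : ℂ) * fracResolventCoeff α (z * ((n : ℝ) ^ (-α) : ℝ)) n := by
    rw [fracResolventCoeff, ← tsum_mul_left]
    refine tsum_congr fun k => ?_
    have e4 : (n : ℝ) ^ (1 - (α * k + α)) = (n : ℝ) ^ (1 - α) * ((n : ℝ) ^ (-α)) ^ k := by
      rw [← Real.rpow_natCast, ← Real.rpow_mul hn'.le, ← Real.rpow_add hn']
      congr 1; ring
    rw [e4]
    push_cast
    ring
  rw [e, norm_mul, Complex.norm_real, Real.norm_of_nonneg (by positivity)]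
  refine mul_le_mul_of_nonneg_left (norm_fracResolventCoeff_le h0.le h1 ?_ ?_ n) (by positivity)
  · rwa [norm_mul, Complex.norm_real, Real.norm_of_nonneg hp]
  · rw [Complex.re_mul_ofReal]
    exact mul_nonpos_of_nonpos_of_nonneg hz hp

/-- The kernel `x₊^(a-1) / Γ(a)` of the Riemann-Liouville integral of order `a`. -/
noncomputable def fracKernel (a x : ℝ) : ℝ := if 0 < x then x ^ (a - 1) / Real.Gamma a else 0

theorem fracKernel_of_pos {a x : ℝ} (hx : 0 < x) :
    fracKernel a x = x ^ (a - 1) / Real.Gamma a := if_pos hx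

theorem fracKernel_of_nonpos {a x : ℝ} (hx : x ≤ 0) : fracKernel a x = 0 := if_neg hx.not_gt

theorem fracKernel_nonneg {a : ℝ} (ha : 0 < a) (x : ℝ) : 0 ≤ fracKernel a x := by
  unfold fracKernel
  have := Real.Gamma_pos_of_pos ha
  split_ifs with h <;> positivity

theorem measurable_fracKernel (a : ℝ) : Measurable (fracKernel a) := by
  unfold fracKernel
  exact Measurable.ite measurableSet_Ioi (by fun_prop) measurable_const

theorem integrable_indicator_fracKernel {a : ℝ} (ha : 0 < a) (t : ℝ) :
    Integrable ((Iio t).indicator (fracKernel a)) := by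
  rw [integrable_indicator_iff measurableSet_Iio]
  have h : IntegrableOn (fracKernel a) (Ioc 0 (max t 0)) := by
    have h1 := (intervalIntegral.intervalIntegrable_rpow' (a := 0) (b := max t 0)
      (show -1 < a - 1 by linarith)).div_const (Real.Gamma a)
    rw [intervalIntegrable_iff_integrableOn_Ioc_of_le (le_max_right _ _)] at h1
    exact h1.congr_fun (fun x hx => (fracKernel_of_pos hx.1).symm) measurableSet_Ioc
  refine h.of_forall_sdiff_eq_zero measurableSet_Iio fun x hx => fracKernel_of_nonpos ?_
  by_contra h0
  exact hx.2 ⟨not_le.1 h0, hx.1.le.trans (le_max_left _ _)⟩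

theorem integral_indicator_fracKernel {a : ℝ} (ha : 0 < a) {t : ℝ} (ht : 0 ≤ t) :
    ∫ x, (Iio t).indicator (fracKernel a) x = t ^ a / Real.Gamma (a + 1) := by
  have h1 : ∫ x, (Iio t).indicator (fracKernel a) x =
      ∫ x in Ioo 0 t, x ^ (a - 1) / Real.Gamma a := by
    rw [← integral_indicator measurableSet_Ioo]
    congr 1
    ext x
    by_cases hx : 0 < x
    · by_cases hxt : x < t <;> simp [indicator, hx, hxt, fracKernel]
    · simp [indicator, hx, fracKernel]
  rw [h1, ← integral_Ioc_eq_integral_Ioo, ← intervalIntegral.integral_of_le ht,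
    intervalIntegral.integral_div, integral_rpow (Or.inl (by linarith)), sub_add_cancel,
    Real.zero_rpow ha.ne', sub_zero, Real.Gamma_add_one ha.ne', div_div]

theorem integrable_fracKernel_mul_fracKernel {a b : ℝ} (ha : 0 < a) (hb : 0 < b) (x : ℝ) :
    Integrable (fun s => fracKernel b s * fracKernel a (x - s)) ∧
      ∫ s, fracKernel b s * fracKernel a (x - s) = fracKernel (a + b) x := by
  rcases le_or_gt x 0 with hx | hx
  · have h0 : (fun s => fracKernel b s * fracKernel a (x - s)) = fun _ => 0 := by
      ext s
      rcases le_or_gt s 0 with hs | hs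
      · rw [fracKernel_of_nonpos hs, zero_mul]
      · rw [fracKernel_of_nonpos (a := a) (show x - s ≤ 0 by linarith), mul_zero]
    rw [h0, fracKernel_of_nonpos hx]
    simp
  · have hI : ∫ s, fracKernel b s * fracKernel a (x - s) = fracKernel (a + b) x := by
      have h1 : (fun s => fracKernel b s * fracKernel a (x - s)) =
          (Ioo 0 x).indicator fun s => s ^ (b - 1) * (x - s) ^ (a - 1) *
            (Real.Gamma b * Real.Gamma a)⁻¹ := by
        ext s
        by_cases hs : 0 < s
        · by_cases hsx : s < x
          · rw [indicator_of_mem (show s ∈ Ioo 0 x from ⟨hs, hsx⟩), fracKernel_of_pos hs, fracKernel_of_pos (sub_pos.2 hsx),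
              mul_inv]
            ring
          · rw [indicator_of_notMem fun h => hsx h.2,
              fracKernel_of_nonpos (a := a) (sub_nonpos.2 (not_lt.1 hsx)), mul_zero]
        · rw [indicator_of_notMem fun h => hs h.1, fracKernel_of_nonpos (not_lt.1 hs), zero_mul]
      have h2 := Complex.betaIntegral_scaled b a hx
      have h3 := Complex.Gamma_mul_Gamma_eq_betaIntegral (s := b) (t := a) (by simpa) (by simpa)
      have h4 : ∫ s in (0 : ℝ)..x, (s : ℂ) ^ ((b : ℂ) - 1) * ((x : ℂ) - s) ^ ((a : ℂ) - 1) =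
          ((∫ s in (0 : ℝ)..x, s ^ (b - 1) * (x - s) ^ (a - 1) : ℝ) : ℂ) := by
        rw [← intervalIntegral.integral_ofReal]
        refine intervalIntegral.integral_congr fun s hs => ?_
        rw [uIcc_of_le hx.le] at hs
        rw [Complex.ofReal_mul, Complex.ofReal_cpow hs.1, Complex.ofReal_cpow (sub_nonneg.2 hs.2)]
        push_cast
        rfl
      rw [h1, integral_indicator measurableSet_Ioo, ← integral_Ioc_eq_integral_Ioo,
        ← intervalIntegral.integral_of_le hx.le, intervalIntegral.integral_mul_const,
        fracKernel_of_pos hx]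
      have hG1 := (Real.Gamma_pos_of_pos ha).ne'
      have hG2 := (Real.Gamma_pos_of_pos hb).ne'
      have hG3 := (Real.Gamma_pos_of_pos (add_pos ha hb)).ne'
      rw [h4] at h2
      apply Complex.ofReal_injective
      rw [Complex.ofReal_mul, h2]
      have e : (x : ℂ) ^ ((b : ℂ) + a - 1) = ((x ^ (a + b - 1) : ℝ) : ℂ) := by
        rw [Complex.ofReal_cpow hx.le]
        push_cast
        rw [add_comm]
      rw [← Complex.ofReal_add, Complex.Gamma_ofReal, Complex.Gamma_ofReal, Complex.Gamma_ofReal,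
        add_comm b a] at h3
      rw [e]
      have hG1' : ((Real.Gamma a : ℝ) : ℂ) ≠ 0 := Complex.ofReal_ne_zero.2 hG1
      have hG2' : ((Real.Gamma b : ℝ) : ℂ) ≠ 0 := Complex.ofReal_ne_zero.2 hG2
      have hG3' : ((Real.Gamma (a + b) : ℝ) : ℂ) ≠ 0 := Complex.ofReal_ne_zero.2 hG3
      have hB : Complex.betaIntegral b a =
          (Real.Gamma b : ℂ) * (Real.Gamma a : ℂ) / (Real.Gamma (a + b) : ℂ) := by
        rw [h3, mul_div_cancel_left₀ _ hG3']
      rw [hB]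
      push_cast
      field_simp
    refine ⟨.of_integral_ne_zero ?_, hI⟩
    rw [hI, fracKernel_of_pos hx]
    have := Real.Gamma_pos_of_pos (add_pos ha hb)
    positivity

/-- Bounded measurable functions on the line that vanish on the nonpositive half line. -/
def IsCausalBounded (f : ℝ → ℂ) : Prop :=
  Measurable f ∧ (∀ s ≤ 0, f s = 0) ∧ ∃ M : ℝ, ∀ s, ‖f s‖ ≤ M

/-- The Riemann-Liouville integral of order `a` of a causal function, as a convolution. -/
noncomputable def fracConv (a : ℝ) (f : ℝ → ℂ) : ℝ → ℂ :=
  convolution f (fun x => (fracKernel a x : ℂ)) (ContinuousLinearMap.mul ℂ ℂ) volume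

theorem fracConv_apply (a : ℝ) (f : ℝ → ℂ) (t : ℝ) :
    fracConv a f t = ∫ s, f s * (fracKernel a (t - s) : ℂ) := rfl

theorem integrable_indicator_fracKernel_sub {a : ℝ} (ha : 0 < a) (t : ℝ) :
    Integrable ((Ioi 0).indicator fun s => fracKernel a (t - s)) := by
  refine ((integrable_indicator_fracKernel ha t).comp_sub_left t).congr (ae_of_all _ fun s => ?_)
  by_cases hs : 0 < s <;> simp [indicator, hs]

theorem integral_indicator_fracKernel_sub {a : ℝ} (ha : 0 < a) {t : ℝ} (ht : 0 ≤ t) :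
    ∫ s, (Ioi 0).indicator (fun s => fracKernel a (t - s)) s = t ^ a / Real.Gamma (a + 1) := by
  rw [← integral_indicator_fracKernel ha ht, ← integral_sub_left_eq_self _ _ t]
  congr 1
  ext s
  simp [indicator]

theorem norm_mul_fracKernel_le {a : ℝ} (ha : 0 < a) {f : ℝ → ℂ} (h0 : ∀ s ≤ 0, f s = 0) {M : ℝ}
    (hM : ∀ s, ‖f s‖ ≤ M) (t s : ℝ) :
    ‖f s * (fracKernel a (t - s) : ℂ)‖ ≤ M * (Ioi 0).indicator (fun s => fracKernel a (t - s)) s := by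
  rcases le_or_gt s 0 with hs | hs
  · rw [h0 s hs, indicator_of_notMem (by simpa using hs)]
    simp
  · rw [indicator_of_mem (by exact hs), norm_mul, Complex.norm_real,
      Real.norm_of_nonneg (fracKernel_nonneg ha _)]
    exact mul_le_mul_of_nonneg_right (hM s) (fracKernel_nonneg ha _)

theorem IsCausalBounded.integrable_mul_fracKernel {f : ℝ → ℂ} (hf : IsCausalBounded f) {a : ℝ}
    (ha : 0 < a) (t : ℝ) : Integrable fun s => f s * (fracKernel a (t - s) : ℂ) := by
  obtain ⟨hm, h0, M, hM⟩ := hf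
  refine ((integrable_indicator_fracKernel_sub ha t).const_mul M).mono' ?_
    (ae_of_all _ fun s => norm_mul_fracKernel_le ha h0 hM t s)
  exact (hm.mul (Complex.measurable_ofReal.comp
    ((measurable_fracKernel a).comp (measurable_const.sub measurable_id)))).aestronglyMeasurable

theorem norm_fracConv_le {a : ℝ} (ha : 0 < a) {f : ℝ → ℂ} (h0 : ∀ s ≤ 0, f s = 0) {M : ℝ}
    (hM : ∀ s, ‖f s‖ ≤ M) {t : ℝ} (ht : 0 ≤ t) :
    ‖fracConv a f t‖ ≤ M * (t ^ a / Real.Gamma (a + 1)) := by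
  rw [fracConv_apply, ← integral_indicator_fracKernel_sub ha ht, ← integral_const_mul]
  exact norm_integral_le_of_norm_le ((integrable_indicator_fracKernel_sub ha t).const_mul M)
    (ae_of_all _ fun s => norm_mul_fracKernel_le ha h0 hM t s)

/-- The semigroup property `I^a I^b = I^(a+b)` of fractional integration. -/
theorem IsCausalBounded.fracConv_fracConv {f : ℝ → ℂ} (hf : IsCausalBounded f) {a b : ℝ}
    (ha : 0 < a) (hb : 0 < b) (t : ℝ) :
    fracConv a (fracConv b f) t = fracConv (a + b) f t := by
  have hnorm (c : ℝ) (hc : 0 < c) (x : ℝ) : ‖(fracKernel c x : ℂ)‖ = fracKernel c x := by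
    rw [Complex.norm_real, Real.norm_of_nonneg (fracKernel_nonneg hc x)]
  have hmeas (c : ℝ) : AEStronglyMeasurable (fun x => (fracKernel c x : ℂ)) volume :=
    (Complex.measurable_ofReal.comp (measurable_fracKernel c)).aestronglyMeasurable
  have hconv : convolution (fun x => fracKernel b x) (fun x => fracKernel a x)
      (ContinuousLinearMap.mul ℝ ℝ) volume = fracKernel (a + b) := by
    ext x
    exact (integrable_fracKernel_mul_fracKernel ha hb x).2
  have hconvC : convolution (fun x => (fracKernel b x : ℂ)) (fun x => (fracKernel a x : ℂ))
      (ContinuousLinearMap.mul ℂ ℂ) volume = fun x => (fracKernel (a + b) x : ℂ) := by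
    ext x
    rw [← (integrable_fracKernel_mul_fracKernel ha hb x).2]
    refine Eq.trans ?_ integral_ofReal
    simp [convolution]
  unfold fracConv
  rw [← hconvC]
  refine convolution_assoc (ContinuousLinearMap.mul ℂ ℂ) (ContinuousLinearMap.mul ℂ ℂ)
    (ContinuousLinearMap.mul ℂ ℂ) (ContinuousLinearMap.mul ℂ ℂ) (fun x y z => mul_assoc x y z)
    hf.1.aestronglyMeasurable (hmeas b) (hmeas a)
    (ae_of_all _ fun y => hf.integrable_mul_fracKernel hb y) (ae_of_all _ fun x => ?_) ?_
  · simp only [hnorm a ha, hnorm b hb]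
    exact (integrable_fracKernel_mul_fracKernel ha hb x).1
  · simp only [hnorm a ha, hnorm b hb, hconv]
    refine (hf.integrable_mul_fracKernel (add_pos ha hb) t).norm.congr (ae_of_all _ fun s => ?_)
    simp only [norm_mul, hnorm (a + b) (add_pos ha hb)]
    rfl

theorem norm_fracConv_sub_le {a : ℝ} (ha : 0 < a) (ha1 : a ≤ 1) {f : ℝ → ℂ}
    (hf : IsCausalBounded f) {M : ℝ} (hM : ∀ s, ‖f s‖ ≤ M) {t t' : ℝ} (ht : 0 ≤ t) (htt : t ≤ t') :
    ‖fracConv a f t' - fracConv a f t‖ ≤ 2 * M / Real.Gamma (a + 1) * (t' - t) ^ a := by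
  have hM0 : 0 ≤ M := (norm_nonneg _).trans (hM 0)
  have hG : 0 < Real.Gamma (a + 1) := Real.Gamma_pos_of_pos (by linarith)
  have hi1 := integrable_indicator_fracKernel_sub ha t
  have hi2 := integrable_indicator_fracKernel_sub ha t'
  have hi3 := (integrable_indicator_fracKernel ha (t' - t)).comp_sub_left t'
  have hbound : ∀ s ≠ t, ‖f s * (fracKernel a (t' - s) : ℂ) - f s * (fracKernel a (t - s) : ℂ)‖ ≤
      M * ((Ioi 0).indicator (fun s => fracKernel a (t - s)) s -
        (Ioi 0).indicator (fun s => fracKernel a (t' - s)) s +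
        2 * (Iio (t' - t)).indicator (fracKernel a) (t' - s)) := by
    intro s hne
    have hk := fracKernel_nonneg ha
    rcases le_or_gt s 0 with hs | hs
    · rw [hf.2.1 s hs, indicator_of_notMem (by simpa using hs), indicator_of_notMem (by simpa using hs)]
      simp only [zero_mul, sub_self, norm_zero, zero_add]
      exact mul_nonneg hM0 (mul_nonneg two_pos.le (indicator_nonneg (fun x _ => hk x) _))
    · rw [indicator_of_mem (by exact hs), indicator_of_mem (by exact hs), ← mul_sub, norm_mul,
        ← Complex.ofReal_sub, Complex.norm_real]
      refine mul_le_mul (hM s) ?_ (norm_nonneg _) hM0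
      rw [Real.norm_eq_abs]
      rcases lt_or_ge s t with hst | hst
      · have h1 : fracKernel a (t' - s) ≤ fracKernel a (t - s) := by
          rw [fracKernel_of_pos (sub_pos.2 hst), fracKernel_of_pos (by linarith)]
          have := Real.Gamma_pos_of_pos ha
          gcongr ?_ / _
          exact Real.rpow_le_rpow_of_nonpos (sub_pos.2 hst) (by linarith) (by linarith)
        have h2 : 0 ≤ (Iio (t' - t)).indicator (fracKernel a) (t' - s) :=
          indicator_nonneg (fun x _ => hk x) _
        rw [abs_sub_comm, abs_of_nonneg (sub_nonneg.2 h1)]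
        linarith
      · rw [fracKernel_of_nonpos (x := t - s) (by linarith), sub_zero, abs_of_nonneg (hk _)]
        rw [indicator_of_mem (by simpa using lt_of_le_of_ne hst hne.symm)]
        linarith [hk (t' - s)]
  rw [fracConv_apply, fracConv_apply, ← integral_sub (hf.integrable_mul_fracKernel ha t')
    (hf.integrable_mul_fracKernel ha t)]
  refine (norm_integral_le_of_norm_le (((hi1.sub hi2).add (hi3.const_mul 2)).const_mul M)
    (((finite_singleton t).countable.ae_notMem volume).mono hbound)).trans ?_
  rw [integral_const_mul]
  have e : ∫ s, ((Ioi 0).indicator (fun s => fracKernel a (t - s)) s -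
        (Ioi 0).indicator (fun s => fracKernel a (t' - s)) s +
        2 * (Iio (t' - t)).indicator (fracKernel a) (t' - s)) =
      t ^ a / Real.Gamma (a + 1) - t' ^ a / Real.Gamma (a + 1) +
        2 * ((t' - t) ^ a / Real.Gamma (a + 1)) := by
    have e1 := integral_add (hi1.sub hi2) (hi3.const_mul 2)
    simp only [Pi.sub_apply] at e1
    rw [e1, integral_sub hi1 hi2, integral_const_mul,
      integral_sub_left_eq_self ((Iio (t' - t)).indicator (fracKernel a)),
      integral_indicator_fracKernel_sub ha ht, integral_indicator_fracKernel_sub ha (ht.trans htt),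
      integral_indicator_fracKernel ha (sub_nonneg.2 htt)]
  have e' : ∀ X Y : ℝ, X ≤ Y → M * X ≤ M * Y := fun X Y h => mul_le_mul_of_nonneg_left h hM0
  refine (le_of_eq (congrArg (M * ·) e)).trans ?_
  have h3 : t ^ a / Real.Gamma (a + 1) ≤ t' ^ a / Real.Gamma (a + 1) := by gcongr
  calc _ ≤ M * (2 * ((t' - t) ^ a / Real.Gamma (a + 1))) := e' _ _ (by linarith)
    _ = _ := by ring

theorem fracConv_of_nonpos {a t : ℝ} {f : ℝ → ℂ} (h0 : ∀ s ≤ 0, f s = 0) (ht : t ≤ 0) :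
    fracConv a f t = 0 := by
  rw [fracConv_apply, integral_eq_zero_of_ae (ae_of_all _ fun s => ?_)]
  rcases le_or_gt s 0 with hs | hs
  · simp [h0 s hs]
  · simp [fracKernel_of_nonpos (a := a) (show t - s ≤ 0 by linarith)]

theorem fracConv_congr {a t : ℝ} {f g : ℝ → ℂ} (hf : ∀ s ≤ 0, f s = 0) (hg : ∀ s ≤ 0, g s = 0)
    (h : ∀ s ∈ Ioo 0 t, f s = g s) : fracConv a f t = fracConv a g t := by
  rw [fracConv_apply, fracConv_apply]
  congr 1
  ext s
  rcases le_or_gt s 0 with hs | hs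
  · rw [hf s hs, hg s hs]
  · rcases lt_or_ge s t with hst | hst
    · rw [h s ⟨hs, hst⟩]
    · simp [fracKernel_of_nonpos (a := a) (show t - s ≤ 0 by linarith)]

theorem fracConv_eq_intervalIntegral {a t : ℝ} (ht : 0 ≤ t) {f g : ℝ → ℂ} (hf : ∀ s ≤ 0, f s = 0)
    (h : ∀ s ∈ Ioo 0 t, f s = g s) :
    fracConv a f t =
      ∫ s in (0 : ℝ)..t, (((t - s) ^ (a - 1) / Real.Gamma a : ℝ) : ℂ) * g s := by
  rw [intervalIntegral.integral_of_le ht, integral_Ioc_eq_integral_Ioo,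
    ← integral_indicator measurableSet_Ioo, fracConv_apply]
  congr 1
  ext s
  rcases le_or_gt s 0 with hs | hs
  · rw [hf s hs, indicator_of_notMem fun h => hs.not_gt h.1, zero_mul]
  · rcases lt_or_ge s t with hst | hst
    · rw [h s ⟨hs, hst⟩, indicator_of_mem (show s ∈ Ioo 0 t from ⟨hs, hst⟩),
        fracKernel_of_pos (sub_pos.2 hst), mul_comm]
    · rw [fracKernel_of_nonpos (a := a) (show t - s ≤ 0 by linarith),
        indicator_of_notMem fun h => hst.not_gt h.2]
      simp

theorem rlIntegral_eq_fracConv {a t : ℝ} (ht : 0 ≤ t) {f g : ℝ → ℂ} (hf : ∀ s ≤ 0, f s = 0)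
    (h : ∀ s ∈ Ioo 0 t, f s = g s) : rlIntegral a g t = fracConv a f t := by
  rw [fracConv_eq_intervalIntegral ht hf h, rlIntegral, ← intervalIntegral.integral_const_mul]
  congr 1
  ext s
  push_cast
  ring

theorem fracConv_one_eq {t : ℝ} (ht : 0 ≤ t) {f g : ℝ → ℂ} (hf : ∀ s ≤ 0, f s = 0)
    (h : ∀ s ∈ Ioo 0 t, f s = g s) : fracConv 1 f t = ∫ s in (0 : ℝ)..t, g s := by
  rw [fracConv_eq_intervalIntegral ht hf h]
  simp

theorem fracConv_add_const_mul {a : ℝ} (ha : 0 < a) {f g : ℝ → ℂ} (hf : IsCausalBounded f)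
    (hg : IsCausalBounded g) (c : ℂ) (t : ℝ) :
    fracConv a (fun s => c * f s + g s) t = c * fracConv a f t + fracConv a g t := by
  simp only [fracConv_apply]
  rw [← integral_const_mul, ← integral_add ((hf.integrable_mul_fracKernel ha t).const_mul c)
    (hg.integrable_mul_fracKernel ha t)]
  congr 1
  ext s
  ring

theorem IsCausalBounded.const_mul_add {f g : ℝ → ℂ} (hf : IsCausalBounded f)
    (hg : IsCausalBounded g) (c : ℂ) : IsCausalBounded fun s => c * f s + g s := by
  obtain ⟨hf1, hf2, M, hM⟩ := hf
  obtain ⟨hg1, hg2, N, hN⟩ := hg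
  refine ⟨(hf1.const_mul c).add hg1, fun s hs => by simp [hf2 s hs, hg2 s hs], ‖c‖ * M + N,
    fun s => (norm_add_le _ _).trans (add_le_add ?_ (hN s))⟩
  rw [norm_mul]
  exact mul_le_mul_of_nonneg_left (hM s) (norm_nonneg _)

theorem IsCausalBounded.continuousOn_fracConv {f : ℝ → ℂ} (hf : IsCausalBounded f) {a : ℝ}
    (ha : 0 < a) (ha1 : a ≤ 1) : ContinuousOn (fracConv a f) (Ici 0) := by
  obtain ⟨M, hM⟩ := hf.2.2
  have key : ∀ t ∈ Ici (0 : ℝ), ∀ t' ∈ Ici (0 : ℝ), ‖fracConv a f t' - fracConv a f t‖ ≤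
      2 * M / Real.Gamma (a + 1) * |t' - t| ^ a := by
    intro t ht t' ht'
    rcases le_total t t' with h | h
    · rw [abs_of_nonneg (sub_nonneg.2 h)]
      exact norm_fracConv_sub_le ha ha1 hf hM ht h
    · rw [norm_sub_rev, abs_sub_comm, abs_of_nonneg (sub_nonneg.2 h)]
      exact norm_fracConv_sub_le ha ha1 hf hM ht' h
  intro t ht
  rw [ContinuousWithinAt, tendsto_iff_norm_sub_tendsto_zero]
  have hc : Tendsto (fun t' => 2 * M / Real.Gamma (a + 1) * |t' - t| ^ a) (𝓝[Ici 0] t) (𝓝 0) := by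
    have : Continuous fun t' => 2 * M / Real.Gamma (a + 1) * |t' - t| ^ a := by
      have : Continuous fun t' => |t' - t| ^ a :=
        (by fun_prop : Continuous fun t' => |t' - t|).rpow_const fun _ => Or.inr ha.le
      fun_prop
    have h := (this.tendsto t).mono_left (nhdsWithin_le_nhds (s := Ici 0))
    simpa [Real.zero_rpow ha.ne'] using h
  exact squeeze_zero' (Eventually.of_forall fun _ => norm_nonneg _)
    (eventually_mem_nhdsWithin.mono fun t' ht' => key t ht t' ht') hc

theorem eqOn_of_forall_intervalIntegral_eq {T : ℝ} (hT : 0 < T) {f g : ℝ → ℂ}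
    (hf : ContinuousOn f (Icc 0 T)) (hg : ContinuousOn g (Icc 0 T))
    (h : ∀ t ∈ Icc 0 T, ∫ s in (0 : ℝ)..t, f s = ∫ s in (0 : ℝ)..t, g s) :
    EqOn f g (Icc 0 T) := by
  have hderiv {F : ℝ → ℂ} (hF : ContinuousOn F (Icc 0 T)) {t : ℝ} (ht : t ∈ Ioo 0 T) :
      HasDerivAt (fun u => ∫ x in (0 : ℝ)..u, F x) (F t) t := by
    have hn : Icc 0 T ∈ 𝓝 t := Icc_mem_nhds ht.1 ht.2
    refine intervalIntegral.integral_hasDerivAt_right ?_ ?_ (hF.continuousAt hn)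
    · refine (hF.mono ?_).intervalIntegrable
      rw [uIcc_of_le ht.1.le]
      exact Icc_subset_Icc_right ht.2.le
    · exact ⟨Icc 0 T, hn, hF.aestronglyMeasurable measurableSet_Icc⟩
  have hI : EqOn f g (Ioo 0 T) := fun t ht => by
    refine (hderiv hf ht).unique ((hderiv hg ht).congr_of_eventuallyEq ?_)
    filter_upwards [Ioo_mem_nhds ht.1 ht.2] with u hu using h u ⟨hu.1.le, hu.2.le⟩
  refine hI.of_subset_closure hf hg Ioo_subset_Icc_self ?_
  rw [closure_Ioo hT.ne]

theorem fracKernel_mul_eq {α x : ℝ} (hx : 0 < x) (c : ℂ) (n : ℕ) :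
    c ^ n * (fracKernel (α * n + α) x : ℂ) =
      ((x ^ (α - 1) : ℝ) : ℂ) * ((c * ((x ^ α : ℝ) : ℂ)) ^ n / (Real.Gamma (α * n + α) : ℂ)) := by
  have e : x ^ (α * n + α - 1) = x ^ (α - 1) * (x ^ α) ^ n := by
    rw [← Real.rpow_natCast, ← Real.rpow_mul hx.le, ← Real.rpow_add hx]
    congr 1; ring
  rw [fracKernel_of_pos hx, e, mul_pow]
  push_cast
  ring

theorem hasSum_fracConv_mittagLeffler {α : ℝ} (hα : 0 < α) {B : ℝ → ℂ} (hB : IsCausalBounded B)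
    (c : ℂ) {t : ℝ} (ht : 0 ≤ t) :
    HasSum (fun n : ℕ => c ^ n * fracConv (α * n + α) B t)
      (∫ s in (0 : ℝ)..t,
        (((t - s) ^ (α - 1) : ℝ) : ℂ) * mittagLeffler α α (c * (((t - s) ^ α : ℝ) : ℂ)) * B s) := by
  obtain ⟨M, hM⟩ := hB.2.2
  have hpos (n : ℕ) : 0 < α * n + α := by positivity
  have hM0 : 0 ≤ M := (norm_nonneg _).trans (hM 0)
  have hint (n : ℕ) := (hB.integrable_mul_fracKernel (hpos n) t).const_mul (c ^ n)
  have hsum : Summable fun n : ℕ =>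
      ∫ s, ‖c ^ n * (B s * (fracKernel (α * n + α) (t - s) : ℂ))‖ := by
    refine Summable.of_nonneg_of_le (fun n => integral_nonneg fun s => norm_nonneg _) (fun n => ?_)
      ((summable_norm_mittagLeffler hα (c * ((t ^ α : ℝ) : ℂ))).mul_left (M * (t ^ α / α)))
    have hG := Real.Gamma_pos_of_pos (hpos n)
    calc ∫ s, ‖c ^ n * (B s * (fracKernel (α * n + α) (t - s) : ℂ))‖
        ≤ ∫ s, ‖c‖ ^ n *
          (M * (Ioi 0).indicator (fun s => fracKernel (α * n + α) (t - s)) s) := by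
          refine integral_mono (hint n).norm
            (((integrable_indicator_fracKernel_sub (hpos n) t).const_mul M).const_mul _)
            fun s => ?_
          simp only
          rw [norm_mul, norm_pow]
          exact mul_le_mul_of_nonneg_left
            (norm_mul_fracKernel_le (hpos n) hB.2.1 hM t s) (by positivity)
      _ = ‖c‖ ^ n * (M * (t ^ (α * n + α) / Real.Gamma (α * n + α + 1))) := by
          rw [integral_const_mul, integral_const_mul,
            integral_indicator_fracKernel_sub (hpos n) ht]
      _ ≤ M * (t ^ α / α) * (‖c‖ ^ n * (t ^ α) ^ n / Real.Gamma (α * n + α)) := by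
          have e : t ^ (α * n + α) = (t ^ α) ^ n * t ^ α := by
            rw [← Real.rpow_natCast, ← Real.rpow_mul ht,
              ← Real.rpow_add_of_nonneg ht (by positivity) hα.le]
          rw [e, Real.Gamma_add_one (hpos n).ne']
          have h1 : M * ‖c‖ ^ n * (t ^ α) ^ n * t ^ α / Real.Gamma (α * n + α) / (α * n + α) ≤
              M * ‖c‖ ^ n * (t ^ α) ^ n * t ^ α / Real.Gamma (α * n + α) / α := by
            gcongr
            have : 0 ≤ α * n := by positivity
            linarith
          calc _ = M * ‖c‖ ^ n * (t ^ α) ^ n * t ^ α / Real.Gamma (α * n + α) / (α * n + α) := by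
                field_simp
            _ ≤ _ := h1
            _ = _ := by field_simp
      _ = _ := by
          rw [norm_div, norm_pow, norm_mul, Complex.norm_real, Complex.norm_real,
            Real.norm_of_nonneg hG.le, Real.norm_of_nonneg (by positivity), mul_pow]
  have h := hasSum_integral_of_summable_integral_norm hint hsum
  have e1 (n : ℕ) : ∫ s, c ^ n * (B s * (fracKernel (α * n + α) (t - s) : ℂ)) =
      c ^ n * fracConv (α * n + α) B t := by rw [integral_const_mul, fracConv_apply]
  simp only [e1] at h
  refine (congrArg (HasSum fun n : ℕ => c ^ n * fracConv (α * n + α) B t) ?_).mpr h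
  rw [intervalIntegral.integral_of_le ht, integral_Ioc_eq_integral_Ioo,
    ← integral_indicator measurableSet_Ioo]
  congr 1
  ext s
  rcases le_or_gt s 0 with hs | hs
  · rw [indicator_of_notMem fun h => hs.not_gt h.1, hB.2.1 s hs]
    simp
  · rcases lt_or_ge s t with hst | hst
    · rw [indicator_of_mem (show s ∈ Ioo 0 t from ⟨hs, hst⟩)]
      have h2 := ((hasSum_mittagLeffler hα (c * (((t - s) ^ α : ℝ) : ℂ))).mul_left
        (((t - s) ^ (α - 1) : ℝ) : ℂ)).mul_right (B s)
      rw [← h2.tsum_eq]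
      refine tsum_congr fun n => ?_
      rw [← fracKernel_mul_eq (sub_pos.2 hst)]
      ring
    · rw [indicator_of_notMem fun h => hst.not_gt h.2]
      simp [fracKernel_of_nonpos (show t - s ≤ 0 by linarith)]

theorem IsCausalBounded.indicator {f : ℝ → ℂ} (hf : Measurable f) {M : ℝ} (hM : ∀ s, ‖f s‖ ≤ M)
    (T : ℝ) : IsCausalBounded ((Ioc 0 T).indicator f) :=
  ⟨hf.indicator measurableSet_Ioc, fun _ hs => indicator_of_notMem (fun h => hs.not_gt h.1) _, M,
    fun s => (norm_indicator_le_norm_self _ _).trans (hM s)⟩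

theorem ContinuousOn.isCausalBounded_indicator {f : ℝ → ℂ} {T : ℝ}
    (hf : ContinuousOn f (Icc 0 T)) : IsCausalBounded ((Ioc 0 T).indicator f) := by
  have hm : Measurable ((Icc 0 T).indicator f) := by
    rw [← piecewise_eq_indicator]
    exact hf.measurable_piecewise continuousOn_const measurableSet_Icc
  obtain ⟨M, hM⟩ := isCompact_Icc.exists_bound_of_continuousOn hf
  have h := IsCausalBounded.indicator hm (M := max M 0) (fun s => ?_) T
  · rwa [indicator_indicator, inter_eq_left.2 Ioc_subset_Icc_self] at h
  · by_cases hs : s ∈ Icc 0 T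
    · rw [indicator_of_mem hs]
      exact (hM s hs).trans (le_max_left _ _)
    · rw [indicator_of_notMem hs, norm_zero]
      exact le_max_right _ _

/-- Duhamel's formula for the scalar equation `∂^α f = c f + b`, `f(0) = 0`. -/
theorem eq_integral_mittagLeffler_of_rlIntegral_eq {α : ℝ} (hα : α ∈ Ioo (0 : ℝ) 1) {T : ℝ}
    (hT : 0 < T) {f b : ℝ → ℂ} (hf : ContinuousOn f (Icc 0 T)) (hf0 : f 0 = 0) (hb : Measurable b)
    {M : ℝ} (hM : ∀ s, ‖b s‖ ≤ M) (c : ℂ)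
    (h : ∀ t ∈ Icc 0 T,
      rlIntegral (1 - α) (fun s => f s - f 0) t = ∫ s in (0 : ℝ)..t, (c * f s + b s)) :
    f T = ∫ s in (0 : ℝ)..T,
      (((T - s) ^ (α - 1) : ℝ) : ℂ) * mittagLeffler α α (c * (((T - s) ^ α : ℝ) : ℂ)) * b s := by
  obtain ⟨h0, h1⟩ := hα
  set F := (Ioc 0 T).indicator f with hFdef
  set B := (Ioc 0 T).indicator b with hBdef
  have hF : IsCausalBounded F := hf.isCausalBounded_indicator
  have hB : IsCausalBounded B := IsCausalBounded.indicator hb hM T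
  have hFe : ∀ s ∈ Ioc 0 T, F s = f s := fun s hs => indicator_of_mem hs _
  have hBe : ∀ s ∈ Ioc 0 T, B s = b s := fun s hs => indicator_of_mem hs _
  set G : ℝ → ℂ := fun s => c * F s + B s with hGdef
  have hG : IsCausalBounded G := hF.const_mul_add hB c
  have e1 : ∀ t ∈ Icc 0 T, fracConv (1 - α) F t = fracConv 1 G t := by
    intro t ht
    rw [fracConv_one_eq ht.1 hG.2.1 (g := fun s => c * f s + b s), ← h t ht]
    · refine (rlIntegral_eq_fracConv ht.1 hF.2.1 fun s hs => ?_).symm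
      rw [hf0, sub_zero, hFe s ⟨hs.1, hs.2.le.trans ht.2⟩]
    · intro s hs
      have hs' : s ∈ Ioc 0 T := ⟨hs.1, hs.2.le.trans ht.2⟩
      simp only [hGdef, hFe s hs', hBe s hs']
  have e2 : ∀ t ∈ Icc 0 T, fracConv 1 F t = fracConv 1 (fracConv α G) t := by
    intro t ht
    have : fracConv α (fracConv (1 - α) F) t = fracConv α (fracConv 1 G) t :=
      fracConv_congr (fun s hs => fracConv_of_nonpos hF.2.1 hs)
        (fun s hs => fracConv_of_nonpos hG.2.1 hs)
        fun s hs => e1 s ⟨hs.1.le, hs.2.le.trans ht.2⟩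
    rw [hF.fracConv_fracConv h0 (by linarith), hG.fracConv_fracConv h0 one_pos, add_comm α 1,
      ← hG.fracConv_fracConv one_pos h0, add_sub_cancel] at this
    exact this
  have e3 : EqOn f (fracConv α G) (Icc 0 T) := by
    refine eqOn_of_forall_intervalIntegral_eq hT hf
      ((hG.continuousOn_fracConv h0 h1.le).mono Icc_subset_Ici_self) fun t ht => ?_
    rw [← fracConv_one_eq ht.1 hF.2.1 fun s hs => hFe s ⟨hs.1, hs.2.le.trans ht.2⟩, e2 t ht,
      fracConv_one_eq ht.1 (fun s hs => fracConv_of_nonpos hG.2.1 hs) fun s _ => rfl]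
  have e4 : ∀ t ∈ Ioc 0 T, F t = c * fracConv α F t + fracConv α B t := fun t ht => by
    rw [hFe t ht, e3 ⟨ht.1.le, ht.2⟩, hGdef, fracConv_add_const_mul h0 hF hB]
  have e5 : ∀ a > 0, ∀ t ∈ Ioc 0 T,
      fracConv a F t = c * fracConv (a + α) F t + fracConv (a + α) B t := by
    intro a ha t ht
    rw [← fracConv_add_const_mul (add_pos ha h0) hF hB, ← hG.fracConv_fracConv ha h0]
    refine fracConv_congr hF.2.1 (fun s hs => fracConv_of_nonpos hG.2.1 hs) fun s hs => ?_
    rw [e4 s ⟨hs.1, hs.2.le.trans ht.2⟩, hGdef, fracConv_add_const_mul h0 hF hB]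
  have hTm : T ∈ Ioc 0 T := ⟨hT, le_rfl⟩
  have e6 : ∀ N : ℕ, f T = ∑ n ∈ Finset.range (N + 1), c ^ n * fracConv (α * n + α) B T +
      c ^ (N + 1) * fracConv (α * N + α) F T := by
    intro N
    induction N with
    | zero =>
      rw [← hFe T hTm, e4 T hTm]
      simp [add_comm]
    | succ N ih =>
      rw [ih, e5 (α * N + α) (by positivity) T hTm, Finset.sum_range_succ _ (N + 1)]
      have : α * (N : ℝ) + α + α = α * ((N + 1 : ℕ) : ℝ) + α := by push_cast; ring
      rw [this]
      ring
  have hS := hasSum_fracConv_mittagLeffler h0 hB c hT.le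
  obtain ⟨K, hK⟩ := hF.2.2
  have hR : Tendsto (fun N : ℕ => c ^ (N + 1) * fracConv (α * N + α) F T) atTop (𝓝 0) := by
    have hs := ((summable_norm_mittagLeffler h0
      (c * ((T ^ α : ℝ) : ℂ))).tendsto_atTop_zero).const_mul (‖c‖ * K * (T ^ α / α))
    rw [mul_zero] at hs
    refine squeeze_zero_norm (fun N => ?_) hs
    have hp : 0 < α * N + α := by positivity
    have hG := Real.Gamma_pos_of_pos hp
    have hK0 : 0 ≤ K := (norm_nonneg _).trans (hK 0)
    have e : T ^ (α * N + α) = (T ^ α) ^ N * T ^ α := by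
      rw [← Real.rpow_natCast, ← Real.rpow_mul hT.le, ← Real.rpow_add hT]
    calc ‖c ^ (N + 1) * fracConv (α * N + α) F T‖
        ≤ ‖c‖ ^ (N + 1) * (K * (T ^ (α * N + α) / Real.Gamma (α * N + α + 1))) := by
          rw [norm_mul, norm_pow]
          exact mul_le_mul_of_nonneg_left (norm_fracConv_le hp hF.2.1 hK hT.le) (by positivity)
      _ = K * ‖c‖ ^ (N + 1) * (T ^ α) ^ N * T ^ α / Real.Gamma (α * N + α) / (α * N + α) := by
          rw [e, Real.Gamma_add_one hp.ne']
          field_simp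
      _ ≤ K * ‖c‖ ^ (N + 1) * (T ^ α) ^ N * T ^ α / Real.Gamma (α * N + α) / α := by
          gcongr
          have : 0 ≤ α * N := by positivity
          linarith
      _ = _ := by
          rw [norm_div, norm_pow, norm_mul, Complex.norm_real, Complex.norm_real,
            Real.norm_of_nonneg hG.le, Real.norm_of_nonneg (by positivity), mul_pow, pow_succ]
          field_simp
  have hlim := ((tendsto_add_atTop_iff_nat 1).2 hS.tendsto_sum_nat).add hR
  simp only [← e6, add_zero] at hlim
  rw [tendsto_nhds_unique tendsto_const_nhds hlim]
  refine intervalIntegral.integral_congr_ae (ae_of_all _ fun s hs => ?_)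
  rw [uIoc_of_le hT.le] at hs
  rw [hBe s hs]

section CompactOperators

variable {H K : Type*} [NormedAddCommGroup H] [InnerProductSpace ℂ H]
  [NormedAddCommGroup K] [InnerProductSpace ℂ K]

/-- A subspace on which a compact operator is bounded below is finite dimensional. -/
theorem IsCompactOperator.finiteDimensional_of_bounded_below {S : H →L[ℂ] H}
    (hS : IsCompactOperator S) {W : Submodule ℂ H} {δ : ℝ} (hδ : 0 < δ)
    (hW : ∀ v ∈ W, δ * ‖v‖ ≤ ‖S v‖) : FiniteDimensional ℂ W := by
  by_contra hfin
  obtain ⟨R, f, hR, hfR, hf⟩ := exists_seq_norm_le_one_le_norm_sub (𝕜 := ℂ) hfin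
  have hK := hS.isCompact_closure_image_closedBall R
  have hmem : ∀ n, S (f n) ∈ closure (S '' Metric.closedBall 0 R) := fun n =>
    subset_closure ⟨f n, by simpa using hfR n, rfl⟩
  obtain ⟨a, -, φ, hφ, ha⟩ := hK.tendsto_subseq hmem
  have hc := ha.cauchySeq
  rw [Metric.cauchySeq_iff'] at hc
  obtain ⟨N, hN⟩ := hc δ hδ
  have h1 := hN (N + 1) (Nat.le_succ N)
  have h2 := hf (hφ (Nat.lt_succ_self N)).ne'
  have h3 := hW _ (f (φ (N + 1)) - f (φ N)).2
  simp only [Function.comp_apply, dist_eq_norm] at h1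
  rw [← map_sub, ← Submodule.coe_sub] at h1
  have h4 : δ * 1 ≤ δ * ‖((f (φ (N + 1)) - f (φ N) : W) : H)‖ :=
    mul_le_mul_of_nonneg_left h2 hδ.le
  linarith

variable [CompleteSpace H]

open Module.End in
/-- A compact symmetric operator of infinite rank has arbitrarily small nonzero eigenvalues. -/
theorem IsCompactOperator.exists_small_eigenvalue {S : H →L[ℂ] H} (hS : IsCompactOperator S)
    (hsymm : (S : H →ₗ[ℂ] H).IsSymmetric) (hrank : ¬ FiniteDimensional ℂ (S : H →ₗ[ℂ] H).range)
    {δ : ℝ} (hδ : 0 < δ) :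
    ∃ (μ : ℂ) (v : H), v ≠ 0 ∧ S v = μ • v ∧ μ ≠ 0 ∧ ‖μ‖ < δ := by
  by_contra! hcon
  set W : Submodule ℂ H := ⨆ μ : {μ : ℂ // δ ≤ ‖μ‖}, eigenspace (S : H →ₗ[ℂ] H) μ with hWdef
  have hbelow : ∀ v ∈ W, δ * ‖v‖ ≤ ‖S v‖ := by
    intro v hv
    obtain ⟨f, hf, rfl⟩ := (Submodule.mem_iSup_iff_exists_finsupp _ _).1 hv
    have horth := hsymm.orthogonalFamily_eigenspaces.comp
      (Subtype.val_injective (p := fun μ : ℂ => δ ≤ ‖μ‖))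
    have e1 := horth.norm_sum (fun μ => ⟨f μ, hf μ⟩) f.support
    have e2 := horth.norm_sum (fun μ => (μ : ℂ) • ⟨f μ, hf μ⟩) f.support
    have e3 : S (f.sum fun _ x => x) = ∑ μ ∈ f.support, (μ : ℂ) • f μ := by
      rw [Finsupp.sum, map_sum]
      exact Finset.sum_congr rfl fun μ _ => mem_eigenspace_iff.1 (hf μ)
    rw [e3, Finsupp.sum]
    refine le_of_sq_le_sq ?_ (norm_nonneg _)
    simp only [Submodule.coe_subtypeₗᵢ, Submodule.coe_subtype, map_smul, norm_smul] at e1 e2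
    rw [mul_pow, e1, e2, Finset.mul_sum]
    refine Finset.sum_le_sum fun μ _ => ?_
    rw [mul_pow]
    have := μ.2
    gcongr
  have hfd : FiniteDimensional ℂ W := hS.finiteDimensional_of_bounded_below hδ hbelow
  have hinv : ∀ v ∈ W, S v ∈ W := by
    intro v hv
    obtain ⟨f, hf, rfl⟩ := (Submodule.mem_iSup_iff_exists_finsupp _ _).1 hv
    rw [Finsupp.sum, map_sum]
    refine Submodule.sum_mem _ fun μ _ => ?_
    have h : S (f μ) = (μ : ℂ) • f μ := mem_eigenspace_iff.1 (hf μ)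
    rw [h]
    exact W.smul_mem _ ((le_iSup (fun μ : {μ : ℂ // δ ≤ ‖μ‖} =>
      eigenspace (S : H →ₗ[ℂ] H) μ) μ) (hf μ))
  have hinv' : ∀ v ∈ Wᗮ, S v ∈ Wᗮ := by
    intro v hv w hw
    exact (hsymm w v).symm.trans (hv _ (hinv w hw))
  let S' : Wᗮ →L[ℂ] Wᗮ := S.restrict hinv'
  have hS' : IsCompactOperator S' := hS.restrict' hinv'
  have hsymm' : (S' : Wᗮ →ₗ[ℂ] Wᗮ).IsSymmetric := hsymm.restrict_invariant hinv'
  have hzero : S' = 0 := by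
    refine (ContinuousLinearMap.eq_zero_of_forall_hasEigenvalue_eq_zero hS' hsymm').1
      fun μ hμ => ?_
    by_contra hμ0
    obtain ⟨v, hv⟩ := hμ.exists_hasEigenvector
    have hv0 : (v : H) ≠ 0 := fun h => hv.2 (Subtype.ext h)
    have hSv : S v = μ • (v : H) := congrArg Subtype.val (mem_eigenspace_iff.1 hv.1)
    have hle := hcon μ v hv0 hSv hμ0
    have hvW : (v : H) ∈ W := (le_iSup (fun μ : {μ : ℂ // δ ≤ ‖μ‖} =>
      eigenspace (S : H →ₗ[ℂ] H) μ) ⟨μ, hle⟩) (mem_eigenspace_iff.2 hSv)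
    exact hv0 (inner_self_eq_zero.1 (v.2 v hvW))
  refine hrank (Submodule.finiteDimensional_of_le (S₂ := W) ?_)
  rintro _ ⟨v, rfl⟩
  obtain ⟨w, hw, z, hz, rfl⟩ := W.exists_add_mem_mem_orthogonal v
  have hz0 : S z = 0 := by
    change ((S' ⟨z, hz⟩ : Wᗮ) : H) = 0
    rw [hzero]
    rfl
  rw [map_add]
  change S w + S z ∈ W
  rw [hz0, add_zero]
  exact hinv w hw

variable [CompleteSpace K]

/-- For a compact embedding `J` of infinite rank the eigenvalue problem
`⟪J v, J p⟫ = μ ⟪v, p⟫` has arbitrarily small positive eigenvalues. -/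
theorem IsCompactOperator.exists_small_singular_value {J : H →L[ℂ] K} (hJ : IsCompactOperator J)
    (hrank : ¬ FiniteDimensional ℂ (J : H →ₗ[ℂ] K).range) {δ : ℝ} (hδ : 0 < δ) :
    ∃ (μ : ℝ) (v : H), J v ≠ 0 ∧ 0 < μ ∧ μ < δ ∧
      ∀ p, inner ℂ (J v) (J p) = (μ : ℂ) * inner ℂ v p := by
  set S : H →L[ℂ] H := (ContinuousLinearMap.adjoint J).comp J with hSdef
  have hinner : ∀ v p, inner ℂ (S v) p = inner ℂ (J v) (J p) := fun v p => by
    rw [hSdef, ContinuousLinearMap.comp_apply, ContinuousLinearMap.adjoint_inner_left]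
  have hsymm : (S : H →ₗ[ℂ] H).IsSymmetric := fun v p => by
    change inner ℂ (S v) p = inner ℂ v (S p)
    rw [hinner, ← inner_conj_symm v, hinner, inner_conj_symm]
  have hS : IsCompactOperator S := by
    rw [hSdef, ContinuousLinearMap.coe_comp]
    exact hJ.clm_comp _
  have hker : (S : H →ₗ[ℂ] H).ker = (J : H →ₗ[ℂ] K).ker := by
    ext v
    simp only [LinearMap.mem_ker, ContinuousLinearMap.coe_coe]
    refine ⟨fun h => ?_, fun h => by rw [hSdef, ContinuousLinearMap.comp_apply, h, map_zero]⟩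
    have := hinner v v
    rw [h, inner_zero_left] at this
    exact inner_self_eq_zero.1 this.symm
  have hrank' : ¬ FiniteDimensional ℂ (S : H →ₗ[ℂ] H).range := fun h => hrank <| by
    have e := (S : H →ₗ[ℂ] H).quotKerEquivRange.symm.finiteDimensional
    rw [hker] at e
    exact (J : H →ₗ[ℂ] K).quotKerEquivRange.finiteDimensional
  obtain ⟨μ, v, hv, hSv, hμ, hμδ⟩ := hS.exists_small_eigenvalue hsymm hrank' hδ
  have h1 : (starRingEnd ℂ) μ * (‖v‖ : ℂ) ^ 2 = (‖J v‖ : ℂ) ^ 2 := by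
    have := hinner v v
    rwa [hSv, inner_smul_left, inner_self_eq_norm_sq_to_K, inner_self_eq_norm_sq_to_K] at this
  have hv' : 0 < ‖v‖ := norm_pos_iff.2 hv
  have h2 : (starRingEnd ℂ) μ = ((‖J v‖ ^ 2 / ‖v‖ ^ 2 : ℝ) : ℂ) := by
    have : (‖v‖ : ℂ) ≠ 0 := by exact_mod_cast hv'.ne'
    push_cast
    rw [eq_div_iff (by positivity), h1]
  have h3 : μ = ((‖J v‖ ^ 2 / ‖v‖ ^ 2 : ℝ) : ℂ) := by
    rw [← Complex.conj_conj μ, h2, Complex.conj_ofReal]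
  have hJv : J v ≠ 0 := fun h => hμ (by rw [h3, h]; simp)
  refine ⟨‖J v‖ ^ 2 / ‖v‖ ^ 2, v, hJv, by have := norm_pos_iff.2 hJv; positivity, ?_, fun p => ?_⟩
  · rwa [h3, Complex.norm_real, Real.norm_of_nonneg (by positivity)] at hμδ
  · rw [← hinner, hSv, inner_smul_left, h2]

end CompactOperators

theorem lintegral_sq_le {X : Type*} [MeasurableSpace X] (μ : Measure X) {f : X → ℝ≥0∞}
    (hf : AEMeasurable f μ) : (∫⁻ x, f x ∂μ) ^ 2 ≤ μ univ * ∫⁻ x, f x ^ 2 ∂μ := by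
  have h := ENNReal.lintegral_mul_le_Lp_mul_Lq μ Real.HolderConjugate.two_two
    (aemeasurable_const (b := (1 : ℝ≥0∞))) hf
  simp only [Pi.mul_apply, one_mul, lintegral_const, ENNReal.rpow_two, one_pow] at h
  calc (∫⁻ x, f x ∂μ) ^ 2 ≤ (μ univ ^ (1 / 2 : ℝ) * (∫⁻ x, f x ^ 2 ∂μ) ^ (1 / 2 : ℝ)) ^ 2 := by
        gcongr
    _ = _ := by
        rw [mul_pow, ← ENNReal.rpow_natCast, ← ENNReal.rpow_natCast, ← ENNReal.rpow_mul,
          ← ENNReal.rpow_mul]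
        norm_num

section Rellich

variable {d : ℕ}

local notation "E" => EuclideanSpace ℝ (Fin d)

theorem norm_fderiv_apply_le_cgrad (φ : E → ℂ) (x h : E) :
    ‖fderiv ℝ φ x h‖ ≤ ‖h‖ * ‖cgrad φ x‖ := by
  have e : fderiv ℝ φ x h = ∑ i, (h i : ℂ) * cgrad φ x i := by
    conv_lhs => rw [← (EuclideanSpace.basisFun (Fin d) ℝ).sum_repr h]
    simp [cgrad]
  rw [e]
  refine (norm_sum_le _ _).trans ?_
  simp only [norm_mul, Complex.norm_real]
  rw [EuclideanSpace.norm_eq, EuclideanSpace.norm_eq]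
  exact Real.sum_mul_le_sqrt_mul_sqrt _ _ _

theorem continuous_cgrad {φ : E → ℂ} (hφ : ContDiff ℝ 1 φ) : Continuous (cgrad φ) := by
  have : Continuous (fderiv ℝ φ) := hφ.continuous_fderiv one_ne_zero
  unfold cgrad
  refine (PiLp.continuous_toLp 2 _).comp (continuous_pi fun i => ?_)
  fun_prop

theorem enorm_translate_sub_le {φ : E → ℂ} (hφ : ContDiff ℝ 1 φ) (x h : E) :
    ‖φ x - φ (x + h)‖ₑ ^ 2 ≤ ‖h‖ₑ ^ 2 * ∫⁻ t in Icc (0 : ℝ) 1, ‖cgrad φ (x + t • h)‖ₑ ^ 2 := by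
  have hc : Continuous fun t : ℝ => fderiv ℝ φ (x + t • h) h := by
    have : Continuous (fderiv ℝ φ) := hφ.continuous_fderiv one_ne_zero
    fun_prop
  have hd : ∀ t ∈ uIcc (0 : ℝ) 1,
      HasDerivAt (fun t : ℝ => φ (x + t • h)) (fderiv ℝ φ (x + t • h) h) t := by
    intro t _
    have h1 : HasDerivAt (fun t : ℝ => x + t • h) h t := by
      simpa using ((hasDerivAt_id t).smul_const h).const_add x
    exact ((hφ.differentiable one_ne_zero).differentiableAt.hasFDerivAt (x := x + t • h)).comp_hasDerivAt t h1
  have h1 := intervalIntegral.integral_eq_sub_of_hasDerivAt hd (hc.intervalIntegrable 0 1)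
  simp only [one_smul, zero_smul, add_zero] at h1
  have hcg : Continuous fun t : ℝ => cgrad φ (x + t • h) :=
    (continuous_cgrad hφ).comp (by fun_prop)
  have hle : ‖φ x - φ (x + h)‖ₑ ≤ ‖h‖ₑ * ∫⁻ t in Icc (0 : ℝ) 1, ‖cgrad φ (x + t • h)‖ₑ := by
    rw [← lintegral_const_mul _ hcg.enorm.measurable, ← enorm_neg, neg_sub, ← h1, intervalIntegral.integral_of_le zero_le_one,
      ← integral_Icc_eq_integral_Ioc]
    refine (enorm_integral_le_lintegral_enorm _).trans (lintegral_mono fun t => ?_)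
    rw [← ofReal_norm, ← ofReal_norm, ← ofReal_norm, ← ENNReal.ofReal_mul (norm_nonneg _)]
    exact ENNReal.ofReal_le_ofReal (norm_fderiv_apply_le_cgrad φ _ h)
  calc _ ≤ (‖h‖ₑ * ∫⁻ t in Icc (0 : ℝ) 1, ‖cgrad φ (x + t • h)‖ₑ) ^ 2 := by gcongr
    _ ≤ _ := by
      rw [mul_pow]
      gcongr
      simpa using lintegral_sq_le (volume.restrict (Icc (0 : ℝ) 1)) hcg.enorm.measurable.aemeasurable

theorem lintegral_translate_sub_le {φ : E → ℂ} (hφ : ContDiff ℝ 1 φ) (h : E) :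
    ∫⁻ x, ‖φ x - φ (x + h)‖ₑ ^ 2 ≤ ‖h‖ₑ ^ 2 * ∫⁻ x, ‖cgrad φ x‖ₑ ^ 2 := by
  have hcg := continuous_cgrad hφ
  calc ∫⁻ x, ‖φ x - φ (x + h)‖ₑ ^ 2
      ≤ ∫⁻ x, ‖h‖ₑ ^ 2 * ∫⁻ t in Icc (0 : ℝ) 1, ‖cgrad φ (x + t • h)‖ₑ ^ 2 :=
        lintegral_mono fun x => enorm_translate_sub_le hφ x h
    _ = ‖h‖ₑ ^ 2 * ∫⁻ t in Icc (0 : ℝ) 1, ∫⁻ x, ‖cgrad φ (x + t • h)‖ₑ ^ 2 := by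
        rw [lintegral_const_mul' _ _ (by simp), lintegral_lintegral_swap]
        refine Measurable.aemeasurable ?_
        have : Continuous fun p : E × ℝ => cgrad φ (p.1 + p.2 • h) := hcg.comp (by fun_prop)
        exact this.enorm.measurable.pow_const 2
    _ = _ := by
        congr 1
        have : ∀ t : ℝ, ∫⁻ x, ‖cgrad φ (x + t • h)‖ₑ ^ 2 = ∫⁻ x, ‖cgrad φ x‖ₑ ^ 2 := fun t =>
          lintegral_add_right_eq_self (fun x => ‖cgrad φ x‖ₑ ^ 2) (t • h)
        simp [this]

/-- The half-open cube of side `η` with index `k`. -/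
def gridCube (η : ℝ) (k : Fin d → ℤ) : Set E := {x | ∀ i, ⌊x i / η⌋ = k i}

theorem mem_gridCube_iff {η : ℝ} (hη : 0 < η) {k : Fin d → ℤ} {x : E} :
    x ∈ gridCube η k ↔ ∀ i, x i ∈ Ico (k i * η) ((k i + 1) * η) := by
  simp only [gridCube, mem_ofPred_eq, Int.floor_eq_iff, mem_Ico, le_div_iff₀ hη, div_lt_iff₀ hη]

theorem gridCube_eq_preimage {η : ℝ} (hη : 0 < η) (k : Fin d → ℤ) :
    (gridCube η k : Set E) =
      WithLp.ofLp ⁻¹' (univ.pi fun i => Ico (k i * η) ((k i + 1) * η)) := by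
  ext x
  rw [mem_gridCube_iff hη]
  simp only [mem_preimage, Set.mem_pi, mem_univ, true_implies]

theorem measurableSet_gridCube {η : ℝ} (hη : 0 < η) (k : Fin d → ℤ) :
    MeasurableSet (gridCube η k : Set E) := by
  rw [gridCube_eq_preimage hη]
  exact (PiLp.volume_preserving_ofLp (Fin d)).measurable
    (MeasurableSet.univ_pi fun i => measurableSet_Ico)

theorem volume_gridCube {η : ℝ} (hη : 0 < η) (k : Fin d → ℤ) :
    volume (gridCube η k : Set E) = ENNReal.ofReal η ^ d := by
  rw [gridCube_eq_preimage hη, (PiLp.volume_preserving_ofLp (Fin d)).measure_preimage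
    (MeasurableSet.univ_pi fun i => measurableSet_Ico).nullMeasurableSet, Real.volume_pi_Ico]
  have (i : Fin d) : ((k i : ℝ) + 1) * η - k i * η = η := by ring
  simp [this]

theorem norm_sub_le_of_mem_gridCube {η : ℝ} (hη : 0 < η) {k : Fin d → ℤ} {x y : E}
    (hx : x ∈ gridCube η k) (hy : y ∈ gridCube η k) : ‖y - x‖ ≤ √d * η := by
  rw [mem_gridCube_iff hη] at hx hy
  rw [EuclideanSpace.norm_eq]
  refine Real.sqrt_le_iff.2 ⟨by positivity, ?_⟩
  rw [mul_pow, Real.sq_sqrt (Nat.cast_nonneg d)]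
  calc ∑ i, ‖(y - x) i‖ ^ 2 ≤ ∑ _i : Fin d, η ^ 2 := by
        refine Finset.sum_le_sum fun i _ => ?_
        rw [Real.norm_eq_abs, sq_abs]
        refine sq_le_sq' ?_ ?_
        · have := (hx i).2; have := (hy i).1
          simp only [PiLp.sub_apply]
          linarith
        · have := (hx i).1; have := (hy i).2
          simp only [PiLp.sub_apply]
          linarith
    _ = d * η ^ 2 := by simp

theorem finite_gridCube_meets {η : ℝ} (hη : 0 < η) {G : Set E} (hG : Bornology.IsBounded G) :
    {k : Fin d → ℤ | (gridCube η k ∩ G).Nonempty}.Finite := by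
  obtain ⟨R, hR⟩ := hG.exists_norm_le
  refine (Set.Finite.pi' (t := fun _ : Fin d => Icc ⌊-R / η⌋ ⌊R / η⌋)
    fun _ => Set.finite_Icc _ _).subset ?_
  rintro k ⟨x, hx, hxG⟩ i
  have h1 : |x i| ≤ R := (PiLp.norm_apply_le x i).trans (hR x hxG)
  rw [← hx i]
  have := abs_le.1 h1
  exact ⟨Int.floor_le_floor (by gcongr; linarith), Int.floor_le_floor (by gcongr; linarith)⟩

/-- Deviation of a function from its mean over a cube. -/
theorem enorm_sub_average_gridCube_sq_le {φ : E → ℂ} (hφ : Continuous φ) (hc : HasCompactSupport φ)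
    {η : ℝ} (hη : 0 < η) {k : Fin d → ℤ} {x : E} (hx : x ∈ gridCube η k) :
    ‖φ x - ((η ^ d)⁻¹ : ℝ) * ∫ y in gridCube η k, φ y‖ₑ ^ 2 ≤
      ENNReal.ofReal (η ^ d)⁻¹ *
        ∫⁻ h in Metric.closedBall (0 : E) (√d * η), ‖φ x - φ (x + h)‖ₑ ^ 2 := by
  have hp : 0 < η ^ d := by positivity
  have hm := measurableSet_gridCube hη k
  have hv := volume_gridCube hη k
  have hvr : volume.real (gridCube η k : Set E) = η ^ d := by
    rw [Measure.real, hv, ← ENNReal.ofReal_pow hη.le, ENNReal.toReal_ofReal hp.le]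
  have hfin : volume (gridCube η k : Set E) ≠ ⊤ := by rw [hv]; finiteness
  have hci : Integrable (fun _ : E => φ x) (volume.restrict (gridCube η k)) :=
    integrableOn_const hfin
  have e : φ x - ((η ^ d)⁻¹ : ℝ) * ∫ y in gridCube η k, φ y =
      ((η ^ d)⁻¹ : ℝ) * ∫ y in gridCube η k, (φ x - φ y) := by
    rw [integral_sub hci (hφ.integrable_of_hasCompactSupport hc).integrableOn,
      setIntegral_const, hvr, Complex.real_smul, mul_sub, ← mul_assoc, ← Complex.ofReal_mul,
      inv_mul_cancel₀ hp.ne']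
    simp
  have hcont : Continuous fun y => φ x - φ y := by fun_prop
  have hcont' : Measurable fun h => ‖φ x - φ (x + h)‖ₑ ^ 2 :=
    (show Continuous fun h => φ x - φ (x + h) by fun_prop).enorm.measurable.pow_const 2
  set A := ENNReal.ofReal (η ^ d)⁻¹ with hA
  have hAv : A * volume (gridCube η k : Set E) = 1 := by
    rw [hA, hv, ← ENNReal.ofReal_pow hη.le, ← ENNReal.ofReal_mul (by positivity),
      inv_mul_cancel₀ hp.ne', ENNReal.ofReal_one]
  have hAe : ‖(((η ^ d)⁻¹ : ℝ) : ℂ)‖ₑ = A := by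
    rw [← ofReal_norm, Complex.norm_real, Real.norm_of_nonneg (by positivity)]
  rw [e, enorm_mul, hAe, mul_pow]
  calc A ^ 2 * ‖∫ y in gridCube η k, (φ x - φ y)‖ₑ ^ 2
      ≤ A ^ 2 * (volume (gridCube η k : Set E) * ∫⁻ y in gridCube η k, ‖φ x - φ y‖ₑ ^ 2) := by
        gcongr
        have h1 := lintegral_sq_le (volume.restrict (gridCube η k : Set E))
          hcont.enorm.measurable.aemeasurable
        rw [Measure.restrict_apply_univ] at h1
        exact le_trans (by gcongr; exact enorm_integral_le_lintegral_enorm _) h1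
    _ = A * ∫⁻ y in gridCube η k, ‖φ x - φ y‖ₑ ^ 2 := by
        rw [sq, ← mul_assoc, mul_assoc A A, hAv, mul_one]
    _ ≤ A * ∫⁻ y in (fun y => y - x) ⁻¹' Metric.closedBall (0 : E) (√d * η),
          ‖φ x - φ (x + (y - x))‖ₑ ^ 2 := by
        simp only [add_sub_cancel]
        gcongr
        intro y hy
        simpa using norm_sub_le_of_mem_gridCube hη hx hy
    _ = _ := by
        congr 1
        exact (measurePreserving_sub_right volume x).setLIntegral_comp_preimage
          Metric.isClosed_closedBall.measurableSet hcont'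

end Rellich

section Rellich

variable {d : ℕ}

local notation "E" => EuclideanSpace ℝ (Fin d)

theorem IsTestFunction.contDiff_one {G : Set E} {φ : E → ℂ} (hφ : IsTestFunction G φ) :
    ContDiff ℝ 1 φ := hφ.1.of_le (by exact_mod_cast le_top)

theorem IsTestFunction.eq_zero_of_notMem {G : Set E} {φ : E → ℂ} (hφ : IsTestFunction G φ) {x : E}
    (hx : x ∉ G) : φ x = 0 := image_eq_zero_of_notMem_tsupport fun h => hx (hφ.2.2 h)

theorem IsTestFunction.cgrad_eq_zero_of_notMem {G : Set E} {φ : E → ℂ} (hφ : IsTestFunction G φ)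
    {x : E} (hx : x ∉ G) : cgrad φ x = 0 := by
  have : fderiv ℝ φ x = 0 :=
    image_eq_zero_of_notMem_tsupport fun h => hx (hφ.2.2 (tsupport_fderiv_subset ℝ h))
  ext i
  simp [cgrad, this]

theorem lintegral_gridCube_deviation_le {φ : E → ℂ} (hφ : ContDiff ℝ 1 φ) {η : ℝ} (hη : 0 < η) :
    ENNReal.ofReal (η ^ d)⁻¹ * ∫⁻ x,
        ∫⁻ h in Metric.closedBall (0 : E) (√d * η), ‖φ x - φ (x + h)‖ₑ ^ 2 ≤
      ENNReal.ofReal (√d ^ d) * volume (Metric.ball (0 : E) 1) * ENNReal.ofReal (√d * η) ^ 2 *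
        ∫⁻ x, ‖cgrad φ x‖ₑ ^ 2 := by
  have hr : 0 ≤ √d * η := by positivity
  have hcont : Continuous fun p : E × E => φ p.1 - φ (p.1 + p.2) := by
    have := hφ.continuous
    fun_prop
  have hm : Measurable fun p : E × E => ‖φ p.1 - φ (p.1 + p.2)‖ₑ ^ 2 :=
    hcont.enorm.measurable.pow_const 2
  rw [lintegral_lintegral_swap hm.aemeasurable]
  calc _ ≤ ENNReal.ofReal (η ^ d)⁻¹ * ∫⁻ _h in Metric.closedBall (0 : E) (√d * η),
        ENNReal.ofReal (√d * η) ^ 2 * ∫⁻ x, ‖cgrad φ x‖ₑ ^ 2 := by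
        refine mul_le_mul' le_rfl (setLIntegral_mono' measurableSet_closedBall fun h hh => ?_)
        refine (lintegral_translate_sub_le hφ h).trans ?_
        gcongr
        rw [← ofReal_norm]
        exact ENNReal.ofReal_le_ofReal (by simpa using hh)
    _ = _ := by
        rw [lintegral_const, Measure.restrict_apply_univ, Measure.addHaar_closedBall _ _ hr,
          finrank_euclideanSpace_fin, mul_pow √d η d,
          ENNReal.ofReal_mul (p := √d ^ d) (by positivity),
          ENNReal.ofReal_inv_of_pos (by positivity)]
        have h1 : ENNReal.ofReal (η ^ d) ≠ 0 := by
          rw [Ne, ENNReal.ofReal_eq_zero, not_le]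
          positivity
        have h2 := ENNReal.inv_mul_cancel h1 ENNReal.ofReal_ne_top
        calc _ = ((ENNReal.ofReal (η ^ d))⁻¹ * ENNReal.ofReal (η ^ d)) *
              (ENNReal.ofReal (√d ^ d) * volume (Metric.ball (0 : E) 1) *
                ENNReal.ofReal (√d * η) ^ 2 * ∫⁻ x, ‖cgrad φ x‖ₑ ^ 2) := by ring
          _ = _ := by rw [h2, one_mul]

/-- The indicator function of a cube, as an element of `L²(G)`. -/
noncomputable def gridCubeLp (G : Set E) {η : ℝ} (hη : 0 < η) (k : Fin d → ℤ) : L2 G :=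
  indicatorConstLp 2 (measurableSet_gridCube hη k)
    (ne_top_of_le_ne_top (by rw [volume_gridCube hη]; finiteness)
      (Measure.restrict_apply_le G (gridCube η k))) 1

/-- The operator which replaces a function by its mean over each of finitely many cubes. -/
noncomputable def gridMean (G : Set E) {η : ℝ} (hη : 0 < η) (K : Finset (Fin d → ℤ)) :
    L2 G →L[ℂ] L2 G :=
  ∑ k ∈ K, (((η ^ d)⁻¹ : ℝ) : ℂ) • (innerSL ℂ (gridCubeLp G hη k)).smulRight (gridCubeLp G hη k)

theorem isCompactOperator_gridMean (G : Set E) {η : ℝ} (hη : 0 < η) (K : Finset (Fin d → ℤ)) :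
    IsCompactOperator (gridMean G hη K) := by
  refine Submodule.sum_mem (compactOperator (RingHom.id ℂ) (L2 G) (L2 G)) fun k _ =>
    Submodule.smul_mem _ _ ?_
  change IsCompactOperator _
  have h : IsCompactOperator (ContinuousLinearMap.toSpanSingleton ℂ (gridCubeLp G hη k)) :=
    isCompactOperator_of_locallyCompactSpace_rng
      (ContinuousLinearMap.toSpanSingleton ℂ (gridCubeLp G hη k))
  exact h.comp_clm (innerSL ℂ (gridCubeLp G hη k))

theorem gridMean_coeFn (G : Set E) {η : ℝ} (hη : 0 < η) {K : Finset (Fin d → ℤ)}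
    (f : L2 G) :
    ∀ᵐ x ∂(volume.restrict G), ∀ k ∈ K, x ∈ gridCube η k → gridMean G hη K f x =
      ((η ^ d)⁻¹ : ℝ) * ∫ y in gridCube η k, f y ∂(volume.restrict G) := by
  have h1 : gridMean G hη K f = ∑ k ∈ K, ((((η ^ d)⁻¹ : ℝ) : ℂ) *
      ∫ y in gridCube η k, f y ∂(volume.restrict G)) • gridCubeLp G hη k := by
    simp only [gridMean, sum_apply, smul_apply,
      ContinuousLinearMap.smulRight_apply, innerSL_apply_apply, smul_smul]
    refine Finset.sum_congr rfl fun k _ => ?_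
    rw [gridCubeLp, L2.inner_indicatorConstLp_one]
  rw [h1]
  have h2 := Lp.coeFn_finsetSum K fun k => ((((η ^ d)⁻¹ : ℝ) : ℂ) *
      ∫ y in gridCube η k, f y ∂(volume.restrict G)) • gridCubeLp G hη k
  have h3 : ∀ᵐ x ∂(volume.restrict G), ∀ k ∈ K, (((((η ^ d)⁻¹ : ℝ) : ℂ) *
      ∫ y in gridCube η k, f y ∂(volume.restrict G)) • gridCubeLp G hη k : L2 G) x =
      ((((η ^ d)⁻¹ : ℝ) : ℂ) * ∫ y in gridCube η k, f y ∂(volume.restrict G)) *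
        (gridCube η k).indicator (fun _ => 1) x := by
    refine (ae_ball_iff (S := (K : Set (Fin d → ℤ))) K.countable_toSet).2 fun k _ => ?_
    filter_upwards [Lp.coeFn_smul ((((η ^ d)⁻¹ : ℝ) : ℂ) *
      ∫ y in gridCube η k, f y ∂(volume.restrict G)) (gridCubeLp G hη k),
      indicatorConstLp_coeFn (p := 2) (hs := measurableSet_gridCube hη k)
        (hμs := ne_top_of_le_ne_top (by rw [volume_gridCube hη]; finiteness)
          (Measure.restrict_apply_le G (gridCube η k))) (c := (1 : ℂ))] with x hx hx'
    rw [hx, Pi.smul_apply, smul_eq_mul, gridCubeLp, hx']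
  filter_upwards [h2, h3] with x hx2 hx3 k hk hxk
  rw [hx2, Finset.sum_apply, Finset.sum_eq_single k]
  · rw [hx3 k hk, indicator_of_mem hxk, mul_one]
  · intro l hl hlk
    rw [hx3 l hl, indicator_of_notMem, mul_zero]
    intro hxl
    exact hlk (funext fun i => (hxl i).symm.trans (hxk i))
  · exact fun h => absurd hk h

theorem L2_enorm_sq {X F : Type*} [MeasurableSpace X] {μ : Measure X} [NormedAddCommGroup F]
    (f : Lp F 2 μ) : ‖f‖ₑ ^ 2 = ∫⁻ x, ‖f x‖ₑ ^ 2 ∂μ := by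
  have h := eLpNorm_nnreal_pow_eq_lintegral (μ := μ) (f := f) (p := 2) two_ne_zero
  rw [Lp.enorm_def]
  simpa using h

theorem setLIntegral_eq_of_eq_zero {G : Set E} (hG : MeasurableSet G) {F : E → ℝ≥0∞}
    (h : ∀ x ∉ G, F x = 0) : ∫⁻ x in G, F x = ∫⁻ x, F x := by
  rw [← lintegral_indicator hG]
  congr 1
  ext x
  by_cases hx : x ∈ G <;> simp [hx, h]

theorem IsTestFunction.enorm_sub_gridMean_sq_le {G : Set E} (hG : IsOpen G) {φ : E → ℂ}
    (hφ : IsTestFunction G φ) {f : L2 G} {g : L2Vec G} (hf : f =ᵐ[volume.restrict G] φ)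
    (hg : g =ᵐ[volume.restrict G] cgrad φ) {η : ℝ} (hη : 0 < η) {K : Finset (Fin d → ℤ)}
    (hK : ∀ k : Fin d → ℤ, (gridCube η k ∩ G).Nonempty → k ∈ K) :
    ‖f - gridMean G hη K f‖ₑ ^ 2 ≤
      ENNReal.ofReal (√d ^ d) * volume (Metric.ball (0 : E) 1) * ENNReal.ofReal (√d * η) ^ 2 *
        ‖g‖ₑ ^ 2 := by
  have hgrad : ‖g‖ₑ ^ 2 = ∫⁻ x, ‖cgrad φ x‖ₑ ^ 2 := by
    rw [L2_enorm_sq, ← setLIntegral_eq_of_eq_zero hG.measurableSet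
      fun x hx => by simp [hφ.cgrad_eq_zero_of_notMem hx]]
    refine lintegral_congr_ae (hg.mono fun x hx => ?_)
    simp only [hx]
  have hmean (k : Fin d → ℤ) :
      ∫ y in gridCube η k, f y ∂(volume.restrict G) = ∫ y in gridCube η k, φ y := by
    have h1 : ∫ y in gridCube η k, f y ∂(volume.restrict G) =
        ∫ y in gridCube η k, φ y ∂(volume.restrict G) := integral_congr_ae (ae_restrict_of_ae hf)
    rw [h1, Measure.restrict_restrict (measurableSet_gridCube hη k), inter_comm,
      setIntegral_eq_of_subset_of_forall_sdiff_eq_zero (measurableSet_gridCube hη k)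
        inter_subset_right fun x hx => hφ.eq_zero_of_notMem fun h => hx.2 ⟨h, hx.1⟩]
  rw [hgrad, L2_enorm_sq]
  refine le_trans ?_ (lintegral_gridCube_deviation_le hφ.contDiff_one hη)
  rw [← lintegral_const_mul' _ _ ENNReal.ofReal_ne_top]
  refine le_trans (lintegral_mono_ae ?_) (setLIntegral_le_lintegral G _)
  filter_upwards [Lp.coeFn_sub f (gridMean G hη K f), hf, gridMean_coeFn G hη (K := K) f,
    ae_restrict_mem hG.measurableSet] with x h1 h2 h3 hxG
  have hxk : x ∈ gridCube η (fun i => ⌊x i / η⌋) := fun i => rfl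
  rw [h1, Pi.sub_apply, h2, h3 _ (hK _ ⟨x, hxk, hxG⟩) hxk, hmean]
  exact enorm_sub_average_gridCube_sq_le hφ.contDiff_one.continuous hφ.2.1 hη hxk

/-- The constant in the cube-wise Poincaré inequality. -/
noncomputable def gridConst (n : ℕ) : ℝ :=
  √((√n ^ n * volume.real (Metric.ball (0 : EuclideanSpace ℝ (Fin n)) 1)) * n)

theorem IsTestFunction.norm_sub_gridMean_le {G : Set E} (hG : IsOpen G) {φ : E → ℂ}
    (hφ : IsTestFunction G φ) {f : L2 G} {g : L2Vec G} (hf : f =ᵐ[volume.restrict G] φ)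
    (hg : g =ᵐ[volume.restrict G] cgrad φ) {η : ℝ} (hη : 0 < η) {K : Finset (Fin d → ℤ)}
    (hK : ∀ k : Fin d → ℤ, (gridCube η k ∩ G).Nonempty → k ∈ K) :
    ‖f - gridMean G hη K f‖ ≤ gridConst d * η * ‖g‖ := by
  have h := hφ.enorm_sub_gridMean_sq_le hG hf hg hη hK
  have hb : volume (Metric.ball (0 : E) 1) = ENNReal.ofReal (volume.real (Metric.ball (0 : E) 1)) :=
    (ENNReal.ofReal_toReal measure_ball_lt_top.ne).symm
  rw [hb, ← ofReal_norm, ← ofReal_norm, ← ENNReal.ofReal_pow (norm_nonneg _),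
    ← ENNReal.ofReal_pow (by positivity), ← ENNReal.ofReal_pow (by positivity),
    ← ENNReal.ofReal_mul (by positivity), ← ENNReal.ofReal_mul (by positivity),
    ← ENNReal.ofReal_mul (by positivity), ENNReal.ofReal_le_ofReal_iff (by positivity)] at h
  unfold gridConst
  refine le_of_sq_le_sq (h.trans (le_of_eq ?_)) (by positivity)
  rw [mul_pow, mul_pow, mul_pow, Real.sq_sqrt (by positivity), Real.sq_sqrt (by positivity)]
  ring

theorem H10.norm_sub_gridMean_le {G : Set E} (hG : IsOpen G) {η : ℝ} (hη : 0 < η)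
    {K : Finset (Fin d → ℤ)} (hK : ∀ k : Fin d → ℤ, (gridCube η k ∩ G).Nonempty → k ∈ K)
    {p : WithLp 2 (L2 G × L2Vec G)} (hp : p ∈ H10 G) :
    ‖p.fst - gridMean G hη K p.fst‖ ≤ gridConst d * η * ‖p.snd‖ := by
  have hcl : IsClosed {p : WithLp 2 (L2 G × L2Vec G) |
      ‖p.fst - gridMean G hη K p.fst‖ ≤ gridConst d * η * ‖p.snd‖} := by
    have h1 : Continuous fun p : WithLp 2 (L2 G × L2Vec G) => p.fst :=
      (WithLp.fstL 2 ℂ (L2 G) (L2Vec G)).continuous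
    have h2 : Continuous fun p : WithLp 2 (L2 G × L2Vec G) => p.snd :=
      (WithLp.sndL 2 ℂ (L2 G) (L2Vec G)).continuous
    exact isClosed_le (by fun_prop) (by fun_prop)
  refine closure_minimal ?_ hcl hp
  intro q hq
  have : ∃ φ, IsTestFunction G φ ∧
      q.fst =ᵐ[volume.restrict G] φ ∧ q.snd =ᵐ[volume.restrict G] cgrad φ := by
    refine Submodule.span_induction (fun x hx => hx) ?_ ?_ ?_ hq
    · refine ⟨0, ⟨contDiff_const, HasCompactSupport.zero, by simp⟩, Lp.coeFn_zero _ _ _, ?_⟩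
      have : cgrad (0 : E → ℂ) = 0 := by
        ext x i
        simp [cgrad]
      rw [this]
      exact Lp.coeFn_zero _ _ _
    · rintro x y - - ⟨φ, hφ, h1, h2⟩ ⟨ψ, hψ, h3, h4⟩
      refine ⟨φ + ψ, ⟨hφ.1.add hψ.1, hφ.2.1.add hψ.2.1,
        (tsupport_add _ _).trans (union_subset hφ.2.2 hψ.2.2)⟩,
        (Lp.coeFn_add _ _).trans (h1.add h3), ?_⟩
      have : cgrad (φ + ψ) = cgrad φ + cgrad ψ := by
        ext x i
        simp [cgrad, fderiv_add (hφ.contDiff_one.differentiable one_ne_zero x)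
          (hψ.contDiff_one.differentiable one_ne_zero x)]
      rw [this]
      exact (Lp.coeFn_add _ _).trans (h2.add h4)
    · rintro c x - ⟨φ, hφ, h1, h2⟩
      refine ⟨c • φ, ⟨hφ.1.const_smul c, hφ.2.1.smul_left (f := fun _ => c),
        (closure_mono (Function.support_const_smul_subset c φ)).trans hφ.2.2⟩,
        (Lp.coeFn_smul _ _).trans (h1.const_smul c), ?_⟩
      have : cgrad (c • φ) = c • cgrad φ := by
        ext x i
        simp [cgrad, fderiv_const_smul (hφ.contDiff_one.differentiable one_ne_zero x)]
      rw [this]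
      exact (Lp.coeFn_smul _ _).trans (h2.const_smul c)
  obtain ⟨φ, hφ, h1, h2⟩ := this
  exact hφ.norm_sub_gridMean_le hG h1 h2 hη hK

/-- The embedding of `H¹₀(G)` into `L²(G)`. -/
noncomputable def H10.toL2 (G : Set E) : H10 G →L[ℂ] L2 G :=
  (WithLp.fstL 2 ℂ (L2 G) (L2Vec G)).comp (H10 G).subtypeL

/-- **Rellich's theorem**: for bounded `G` the embedding of `H¹₀(G)` into `L²(G)` is compact. -/
theorem H10.isCompactOperator_toL2 {G : Set E} (hG : IsOpen G) (hGb : Bornology.IsBounded G) :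
    IsCompactOperator (H10.toL2 G) := by
  have hη (n : ℕ) : (0 : ℝ) < 1 / ((n : ℝ) + 1) := by positivity
  let F : ℕ → H10 G →L[ℂ] L2 G := fun n =>
    (gridMean G (hη n) (finite_gridCube_meets (hη n) hGb).toFinset).comp (H10.toL2 G)
  refine isCompactOperator_of_tendsto (l := atTop) (F := F) ?_ (Eventually.of_forall fun n => ?_)
  · refine (@tendsto_iff_norm_sub_tendsto_zero ℕ (H10 G →L[ℂ] L2 G) _ F atTop (H10.toL2 G)).2 ?_
    have hlim : Tendsto (fun n : ℕ => gridConst d * (1 / ((n : ℝ) + 1))) atTop (𝓝 0) := by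
      simpa using tendsto_one_div_add_atTop_nhds_zero_nat.const_mul (gridConst d)
    refine squeeze_zero (fun n => norm_nonneg (F n - H10.toL2 G)) (fun n => ?_) hlim
    have hc : 0 ≤ gridConst d * (1 / ((n : ℝ) + 1)) :=
      mul_nonneg (Real.sqrt_nonneg _) (hη n).le
    refine ContinuousLinearMap.opNorm_le_bound _ hc fun p => ?_
    rw [sub_apply, norm_sub_rev]
    refine (H10.norm_sub_gridMean_le hG (hη n) (fun k hk => by simpa using hk) p.2).trans
      (mul_le_mul_of_nonneg_left ?_ hc)
    exact WithLp.norm_snd_le _ (p : WithLp 2 (L2 G × L2Vec G))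
  · exact (isCompactOperator_gridMean G (hη n) _).comp_clm (H10.toL2 G)

end Rellich

section Eigenfunctions

variable {d : ℕ}

theorem IsTestFunction.exists_mem_H10 {G : Set (EuclideanSpace ℝ (Fin d))}
    {φ : EuclideanSpace ℝ (Fin d) → ℂ} (hφ : IsTestFunction G φ) :
    ∃ p : H10 G, H10.toL2 G p =ᵐ[volume.restrict G] φ := by
  have h1 : MemLp φ 2 (volume.restrict G) :=
    hφ.contDiff_one.continuous.memLp_of_hasCompactSupport hφ.2.1
  have hc : HasCompactSupport (cgrad φ) := by
    refine HasCompactSupport.intro hφ.2.1 fun x hx => ?_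
    have : fderiv ℝ φ x = 0 :=
      image_eq_zero_of_notMem_tsupport fun h => hx (tsupport_fderiv_subset ℝ h)
    ext i
    simp [cgrad, this]
  have h2 : MemLp (cgrad φ) 2 (volume.restrict G) :=
    (continuous_cgrad hφ.contDiff_one).memLp_of_hasCompactSupport hc
  refine ⟨⟨WithLp.toLp 2 (h1.toLp φ, h2.toLp (cgrad φ)), Submodule.le_topologicalClosure _
    (Submodule.subset_span ⟨φ, hφ, h1.coeFn_toLp, h2.coeFn_toLp⟩)⟩, h1.coeFn_toLp⟩

theorem H10.not_finiteDimensional_range_toL2 (hd : 1 ≤ d) {G : Set (EuclideanSpace ℝ (Fin d))}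
    (hG : IsOpen G) (hGne : G.Nonempty) :
    ¬ FiniteDimensional ℂ (H10.toL2 G : H10 G →ₗ[ℂ] L2 G).range := by
  intro hfin
  have : Nonempty (Fin d) := ⟨⟨0, hd⟩⟩
  obtain ⟨x₀, hx₀⟩ := hGne
  have hinf : G.Infinite := infinite_of_mem_nhds x₀ (hG.mem_nhds hx₀)
  obtain ⟨t, htG, htc⟩ :=
    hinf.exists_subset_card_eq (Module.finrank ℂ (H10.toL2 G : H10 G →ₗ[ℂ] L2 G).range + 1)
  obtain ⟨U, hU, hdisj⟩ := t.finite_toSet.t2_separation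
  have hbump : ∀ x : t, ∃ p : H10 G, ∃ φ : EuclideanSpace ℝ (Fin d) → ℂ, Continuous φ ∧
      φ x = 1 ∧ tsupport φ ⊆ U x ∧ H10.toL2 G p =ᵐ[volume.restrict G] φ := by
    intro x
    obtain ⟨f, hf1, hf2, hf3, -, hf5⟩ := exists_contDiff_tsupport_subset (n := ⊤)
      (((hU x).2.inter hG).mem_nhds ⟨(hU x).1, htG x.2⟩)
    have hs : tsupport (fun y => (f y : ℂ)) ⊆ tsupport f :=
      closure_mono fun y hy h => hy (by simp [h])
    have hφ : IsTestFunction G fun y => (f y : ℂ) :=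
      ⟨Complex.ofRealCLM.contDiff.comp hf3, hf2.comp_left Complex.ofReal_zero,
        hs.trans (hf1.trans inter_subset_right)⟩
    obtain ⟨p, hp⟩ := hφ.exists_mem_H10
    exact ⟨p, _, hφ.contDiff_one.continuous, by simp [hf5],
      hs.trans (hf1.trans inter_subset_left), hp⟩
  choose p φ hφc hφ1 hφU hφ using hbump
  have hne : ∀ x, H10.toL2 G (p x) ≠ 0 := by
    intro x h
    have h0 : φ x =ᵐ[volume.restrict G] (fun _ => 0) := by
      have h1 := hφ x
      rw [h] at h1
      exact h1.symm.trans (Lp.coeFn_zero _ _ _)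
    have h2 := Measure.eqOn_open_of_ae_eq h0 hG (hφc x).continuousOn continuousOn_const
      (htG x.2)
    rw [hφ1] at h2
    exact one_ne_zero h2
  have horth : Pairwise fun x y => inner ℂ (H10.toL2 G (p x)) (H10.toL2 G (p y)) = 0 := by
    intro x y hxy
    rw [L2.inner_def]
    refine integral_eq_zero_of_ae ?_
    filter_upwards [hφ x, hφ y] with z hz1 hz2
    rw [hz1, hz2, Pi.zero_apply]
    have hd := hdisj x.2 y.2 (Subtype.coe_injective.ne hxy)
    by_cases hz : z ∈ U x
    · rw [image_eq_zero_of_notMem_tsupport (f := φ y)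
        fun h => (Set.disjoint_left.1 hd hz) (hφU y h), inner_zero_right]
    · rw [image_eq_zero_of_notMem_tsupport (f := φ x) fun h => hz (hφU x h), inner_zero_left]
  have hli := linearIndependent_of_ne_zero_of_inner_eq_zero hne horth
  have hli' : LinearIndependent ℂ fun x : t =>
      (⟨H10.toL2 G (p x), p x, rfl⟩ : (H10.toL2 G : H10 G →ₗ[ℂ] L2 G).range) :=
    LinearIndependent.of_comp (Submodule.subtype _) hli
  have hcard := hli'.fintype_card_le_finrank
  rw [Fintype.card_coe, htc] at hcard
  omega

/-- The Dirichlet Laplacian of a bounded open set has arbitrarily large eigenvalues. -/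
theorem H10.exists_large_eigenvalue (hd : 1 ≤ d) {G : Set (EuclideanSpace ℝ (Fin d))}
    (hG : IsOpen G) (hGb : Bornology.IsBounded G) (hGne : G.Nonempty) {Λ : ℝ} (hΛ : 0 ≤ Λ) :
    ∃ (l : ℝ) (v : WithLp 2 (L2 G × L2Vec G)), Λ ≤ l ∧ v ∈ H10 G ∧ ‖v.fst‖ = 1 ∧
      ∀ p ∈ H10 G, inner ℂ v.snd p.snd = (l : ℂ) * inner ℂ v.fst p.fst := by
  have hcl : IsClosed (H10 G : Set (WithLp 2 (L2 G × L2Vec G))) :=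
    Submodule.isClosed_topologicalClosure _
  have : CompleteSpace (H10 G) := hcl.completeSpace_coe
  obtain ⟨μ, v, hv, hμ, hμΛ, h⟩ :=
    (H10.isCompactOperator_toL2 hG hGb).exists_small_singular_value
      (H10.not_finiteDimensional_range_toL2 hd hG hGne) (δ := 1 / (Λ + 1)) (by positivity)
  set c : ℂ := ((‖H10.toL2 G v‖⁻¹ : ℝ) : ℂ) with hc
  have hn : 0 < ‖H10.toL2 G v‖ := norm_pos_iff.2 hv
  refine ⟨1 / μ - 1, c • (v : WithLp 2 (L2 G × L2Vec G)), ?_, (H10 G).smul_mem _ v.2, ?_,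
    fun p hp => ?_⟩
  · rw [lt_div_iff₀ (by positivity)] at hμΛ
    rw [le_sub_iff_add_le, le_div_iff₀ hμ]
    linarith
  · change ‖c • H10.toL2 G v‖ = 1
    rw [norm_smul, hc, Complex.norm_real, Real.norm_of_nonneg (by positivity),
      inv_mul_cancel₀ hn.ne']
  · have h1 := h ⟨p, hp⟩
    change inner ℂ (v : WithLp 2 (L2 G × L2Vec G)).fst p.fst =
      (μ : ℂ) * inner ℂ (v : WithLp 2 (L2 G × L2Vec G)) p at h1
    rw [WithLp.prod_inner_apply] at h1
    rw [WithLp.smul_fst, WithLp.smul_snd, inner_smul_left, inner_smul_left]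
    have hμ' : (μ : ℂ) ≠ 0 := Complex.ofReal_ne_zero.2 hμ.ne'
    push_cast
    change inner ℂ (v : WithLp 2 (L2 G × L2Vec G)).fst p.fst = (μ : ℂ) *
      (inner ℂ (v : WithLp 2 (L2 G × L2Vec G)).fst p.fst +
        inner ℂ (v : WithLp 2 (L2 G × L2Vec G)).snd p.snd) at h1
    field_simp
    linear_combination -(starRingEnd ℂ c) * h1

end Eigenfunctions

section Control

variable {d : ℕ}

theorem lintegral_enorm_sq_le_L2 (G : Set (EuclideanSpace ℝ (Fin d))) (f : L2 G) :
    (∫⁻ x in G, ‖f x‖ₑ) ^ 2 ≤ volume G * ‖f‖ₑ ^ 2 := by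
  have h := lintegral_sq_le (volume.restrict G) (Lp.aestronglyMeasurable f).enorm
  rwa [Measure.restrict_apply_univ, ← L2_enorm_sq] at h

/-- The component `⟨1_{G₀} u(t), f⟩` of a control, up to a null set of times. -/
theorem exists_measurable_bounded_control_component {T : ℝ} {G G₀ : Set (EuclideanSpace ℝ (Fin d))}
    (hGfin : volume G ≠ ⊤) (hG₀ : NullMeasurableSet G₀ volume) (hG₀G : G₀ ⊆ G)
    (u : Control T G₀) (f : L2 G) :
    ∃ b : ℝ → ℂ, Measurable b ∧ (∀ s, ‖b s‖ ≤ ‖u‖ * (√(volume.real G) * ‖f‖)) ∧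
      ∀ᵐ t ∂(volume.restrict (Ioo 0 T)),
        ∫ x in G, starRingEnd ℂ (f x) * G₀.indicator (fun x => u (t, x)) x = b t := by
  have hrestr : (volume.restrict G).restrict G₀ = volume.restrict G₀ := by
    rw [Measure.restrict_restrict₀ (hG₀.mono_ac Measure.absolutelyContinuous_restrict),
      inter_eq_left.2 hG₀G]
  set b₀ : ℝ → ℂ := fun t => ∫ x in G₀, starRingEnd ℂ (f x) * u (t, x) with hb₀
  have hb₀m : Measurable b₀ := by
    have h1 : StronglyMeasurable fun p : ℝ × EuclideanSpace ℝ (Fin d) =>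
        starRingEnd ℂ (f p.2) * u p := by
      refine StronglyMeasurable.mul ?_ (Lp.stronglyMeasurable u)
      exact (Complex.continuous_conj.comp_stronglyMeasurable
        ((Lp.stronglyMeasurable f).comp_measurable measurable_snd))
    exact h1.integral_prod_right'.measurable
  have heq (t : ℝ) :
      ∫ x in G, starRingEnd ℂ (f x) * G₀.indicator (fun x => u (t, x)) x = b₀ t := by
    have h1 (g : EuclideanSpace ℝ (Fin d) → ℂ) :
        ∫ x in G₀, g x = ∫ x in G, G₀.indicator g x := by
      rw [integral_indicator₀ (hG₀.mono_ac Measure.absolutelyContinuous_restrict), hrestr]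
    rw [hb₀]
    simp only [h1]
    congr 1
    ext x
    by_cases hx : x ∈ G₀ <;> simp [hx]
  have hbound : ∀ᵐ t ∂(volume.restrict (Ioo 0 T)),
      ‖b₀ t‖ ≤ ‖u‖ * (√(volume.real G) * ‖f‖) := by
    have hu : ∀ᵐ p ∂((volume.restrict (Ioo 0 T)).prod (volume.restrict G₀)), ‖u p‖ₑ ≤ ‖u‖ₑ := by
      rw [Lp.enorm_def, eLpNorm_exponent_top]
      exact ae_le_eLpNormEssSup
    filter_upwards [Measure.ae_ae_of_ae_prod hu] with t ht
    have h1 : ‖b₀ t‖ₑ ≤ ‖u‖ₑ * ∫⁻ x in G, ‖f x‖ₑ := by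
      rw [← lintegral_const_mul' _ _ (by simp)]
      refine (enorm_integral_le_lintegral_enorm _).trans
        ((lintegral_mono_ae (ht.mono fun x hx => ?_)).trans
          (lintegral_mono' (Measure.restrict_mono hG₀G le_rfl) le_rfl))
      rw [enorm_mul, mul_comm]
      gcongr
      rw [← ofReal_norm, ← ofReal_norm, RCLike.norm_conj]
    have h2 : ‖b₀ t‖ₑ ^ 2 ≤ ‖u‖ₑ ^ 2 * (volume G * ‖f‖ₑ ^ 2) := by
      calc ‖b₀ t‖ₑ ^ 2 ≤ (‖u‖ₑ * ∫⁻ x in G, ‖f x‖ₑ) ^ 2 := by gcongr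
        _ ≤ _ := by
          rw [mul_pow]
          gcongr
          exact lintegral_enorm_sq_le_L2 G f
    rw [← ENNReal.ofReal_toReal hGfin, ← ofReal_norm, ← ofReal_norm, ← ofReal_norm,
      ← ENNReal.ofReal_pow (norm_nonneg _), ← ENNReal.ofReal_pow (norm_nonneg _),
      ← ENNReal.ofReal_pow (norm_nonneg _), ← ENNReal.ofReal_mul ENNReal.toReal_nonneg,
      ← ENNReal.ofReal_mul (by positivity), ENNReal.ofReal_le_ofReal_iff (by positivity)] at h2
    refine le_of_sq_le_sq (h2.trans (le_of_eq ?_)) (by positivity)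
    rw [mul_pow, mul_pow, Real.sq_sqrt measureReal_nonneg]
    rfl
  have hM : 0 ≤ ‖u‖ * (√(volume.real G) * ‖f‖) := by positivity
  have hset : MeasurableSet {t | ‖b₀ t‖ ≤ ‖u‖ * (√(volume.real G) * ‖f‖)} :=
    measurableSet_le hb₀m.norm measurable_const
  refine ⟨_, hb₀m.indicator hset, fun s => ?_, ?_⟩
  · by_cases hs : s ∈ {t | ‖b₀ t‖ ≤ ‖u‖ * (√(volume.real G) * ‖f‖)}
    · rw [indicator_of_mem hs]
      exact hs
    · rw [indicator_of_notMem hs, norm_zero]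
      exact hM
  · filter_upwards [hbound] with t ht
    exact (heq t).trans (indicator_of_mem (s := {t | ‖b₀ t‖ ≤ ‖u‖ * (√(volume.real G) * ‖f‖)}) ht b₀).symm

/-- The component of a weak solution along an eigenfunction of the Dirichlet Laplacian. -/
theorem IsWeakSolution.inner_eq_integral {α : ℝ} (hα : α ∈ Ioo (0 : ℝ) 1) {T : ℝ} (hT : 0 < T)
    {G G₀ : Set (EuclideanSpace ℝ (Fin d))} {ξ : ℝ} {u : Control T G₀} {y : ℝ → L2 G}
    (hy : IsWeakSolution α T G G₀ ξ 0 u y) {l : ℝ} {v : WithLp 2 (L2 G × L2Vec G)}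
    (hv : v ∈ H10 G) (hl : ∀ p ∈ H10 G, inner ℂ v.snd p.snd = (l : ℂ) * inner ℂ v.fst p.fst)
    {b : ℝ → ℂ} (hb : Measurable b) {M : ℝ} (hM : ∀ s, ‖b s‖ ≤ M)
    (hub : ∀ᵐ t ∂(volume.restrict (Ioo 0 T)),
        ∫ x in G, starRingEnd ℂ (v.fst x) * G₀.indicator (fun x => u (t, x)) x = b t) :
    inner ℂ v.fst (y T) = ∫ s in (0 : ℝ)..T, (((T - s) ^ (α - 1) : ℝ) : ℂ) *
      mittagLeffler α α (Complex.I * ((-l * (T - s) ^ α : ℝ) : ℂ) * ξ) * b s := by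
  obtain ⟨hyc, hy0, Y, -, hY, hweak⟩ := hy
  obtain ⟨hfc, -, hcap⟩ := hweak v hv
  have h := eq_integral_mittagLeffler_of_rlIntegral_eq hα hT hfc (by simp [hy0]) hb hM
    (-(Complex.I * ξ * l)) fun t ht => by
      rw [hcap t ht]
      rw [intervalIntegral.integral_of_le ht.1, intervalIntegral.integral_of_le ht.1,
        integral_Ioc_eq_integral_Ioo, integral_Ioc_eq_integral_Ioo]
      refine integral_congr_ae (ae_restrict_of_ae_restrict_of_subset
        (Ioo_subset_Ioo_right ht.2) ?_)
      filter_upwards [hY, hub] with s hs1 hs2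
      rw [hs2, hl _ (Y s).2, hs1]
      ring
  refine h.trans (intervalIntegral.integral_congr fun s _ => ?_)
  congr 3
  push_cast
  ring

end Control

section Averaging

variable {Ω : Type*} [MeasurableSpace Ω] {P : Measure Ω} {ξ : Ω → ℝ}

theorem norm_mittagLeffler_I_mul_le {α : ℝ} (hα : α ∈ Ioo (0 : ℝ) 1) (s x : ℝ) :
    ‖mittagLeffler α α (Complex.I * s * x)‖ ≤ (Real.Gamma α)⁻¹ :=
  norm_mittagLeffler_le hα.1 hα.2.le (by simp)

theorem measurable_fracCharFun [SFinite P] (hξ : Measurable ξ) {α : ℝ} (hα : 0 < α) :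
    Measurable (fracCharFun P ξ α α) := by
  have h : StronglyMeasurable fun p : ℝ × Ω => mittagLeffler α α (Complex.I * p.1 * ξ p.2) :=
    ((measurable_mittagLeffler hα).comp (by fun_prop)).stronglyMeasurable
  exact h.integral_prod_right'.measurable

theorem norm_fracCharFun_le [IsProbabilityMeasure P] {α : ℝ} (hα : α ∈ Ioo (0 : ℝ) 1) (s : ℝ) :
    ‖fracCharFun P ξ α α s‖ ≤ (Real.Gamma α)⁻¹ := by
  have h := norm_integral_le_of_norm_le_const (μ := P)
    (ae_of_all _ fun ω => norm_mittagLeffler_I_mul_le hα s (ξ ω))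
  rwa [probReal_univ, mul_one] at h

theorem integrableOn_rpow_sub {α : ℝ} (hα : 0 < α) {T : ℝ} (hT : 0 ≤ T) :
    IntegrableOn (fun s => (T - s) ^ (α - 1)) (Ioc 0 T) := by
  have h := (intervalIntegral.intervalIntegrable_rpow' (a := T) (b := 0)
    (show -1 < α - 1 by linarith)).comp_sub_left T
  simp only [sub_self, sub_zero] at h
  exact (intervalIntegrable_iff_integrableOn_Ioc_of_le hT).1 h

theorem integral_integral_mittagLeffler [IsProbabilityMeasure P] (hξ : Measurable ξ) {α : ℝ}
    (hα : α ∈ Ioo (0 : ℝ) 1) {T : ℝ} (hT : 0 ≤ T) (l : ℝ) {b : ℝ → ℂ} (hb : Measurable b) {M : ℝ}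
    (hM : ∀ s, ‖b s‖ ≤ M) :
    ∫ ω, (∫ s in (0 : ℝ)..T, (((T - s) ^ (α - 1) : ℝ) : ℂ) *
        mittagLeffler α α (Complex.I * ((-l * (T - s) ^ α : ℝ) : ℂ) * ξ ω) * b s) ∂P =
      ∫ s in (0 : ℝ)..T, (((T - s) ^ (α - 1) : ℝ) : ℂ) *
        fracCharFun P ξ α α (-l * (T - s) ^ α) * b s := by
  simp only [intervalIntegral.integral_of_le hT]
  rw [integral_integral_swap]
  · congr 1
    ext s
    rw [integral_mul_const, integral_const_mul, fracCharFun]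
  · have hm : Measurable fun p : Ω × ℝ => (((T - p.2) ^ (α - 1) : ℝ) : ℂ) *
        mittagLeffler α α (Complex.I * ((-l * (T - p.2) ^ α : ℝ) : ℂ) * ξ p.1) * b p.2 := by
      refine (Measurable.mul (by fun_prop) ?_).mul (hb.comp measurable_snd)
      exact (measurable_mittagLeffler hα.1).comp (by fun_prop)
    have hint : Integrable (fun p : Ω × ℝ => (1 : ℝ) * ((T - p.2) ^ (α - 1) * ((Real.Gamma α)⁻¹ * M)))
        (P.prod (volume.restrict (Ioc 0 T))) :=
      (integrable_const (1 : ℝ)).mul_prod ((integrableOn_rpow_sub hα.1 hT).mul_const _)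
    refine hint.mono' hm.aestronglyMeasurable ?_
    have hmem : ∀ᵐ p ∂(P.prod (volume.restrict (Ioc 0 T))), p.2 ∈ Ioc 0 T :=
      Measure.quasiMeasurePreserving_snd.ae (ae_restrict_mem measurableSet_Ioc)
    filter_upwards [hmem] with p hp
    have h0 : 0 ≤ (T - p.2) ^ (α - 1) := Real.rpow_nonneg (sub_nonneg.2 hp.2) _
    simp only [Function.uncurry]
    rw [norm_mul, norm_mul, Complex.norm_real, Real.norm_of_nonneg h0, one_mul, mul_assoc]
    refine mul_le_mul_of_nonneg_left ?_ h0
    have hG : 0 ≤ (Real.Gamma α)⁻¹ := inv_nonneg.2 (Real.Gamma_pos_of_pos hα.1).le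
    exact mul_le_mul (norm_mittagLeffler_I_mul_le hα _ _) (hM _) (norm_nonneg _) hG

theorem tendsto_integral_fracCharFun [IsProbabilityMeasure P] (hξ : Measurable ξ) {α : ℝ}
    (hα : α ∈ Ioo (0 : ℝ) 1) (hφ : Tendsto (fracCharFun P ξ α α) (cocompact ℝ) (𝓝 0)) {T : ℝ}
    (hT : 0 ≤ T) {l : ℕ → ℝ} (hl : Tendsto l atTop atTop) :
    Tendsto (fun n => ∫ s in (0 : ℝ)..T,
      (T - s) ^ (α - 1) * ‖fracCharFun P ξ α α (-l n * (T - s) ^ α)‖) atTop (𝓝 0) := by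
  simp only [intervalIntegral.integral_of_le hT, integral_Ioc_eq_integral_Ioo]
  have h0 : ∫ _ in Ioo (0 : ℝ) T, (0 : ℝ) = 0 := by simp
  suffices h : Tendsto (fun n => ∫ s in Ioo 0 T,
      (T - s) ^ (α - 1) * ‖fracCharFun P ξ α α (-l n * (T - s) ^ α)‖) atTop
      (𝓝 (∫ _ in Ioo (0 : ℝ) T, (0 : ℝ))) by rwa [h0] at h
  refine tendsto_integral_of_dominated_convergence
    (fun s => (T - s) ^ (α - 1) * (Real.Gamma α)⁻¹) (fun n => ?_) ?_ (fun n => ?_) ?_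
  · refine Measurable.aestronglyMeasurable (Measurable.mul (by fun_prop) (Measurable.norm ?_))
    exact (measurable_fracCharFun hξ hα.1).comp (by fun_prop)
  · exact ((integrableOn_rpow_sub hα.1 hT).mono_set Ioo_subset_Ioc_self).mul_const _
  · filter_upwards [ae_restrict_mem measurableSet_Ioo] with s hs
    have h0 : 0 ≤ (T - s) ^ (α - 1) := Real.rpow_nonneg (sub_nonneg.2 hs.2.le) _
    rw [norm_mul, Real.norm_of_nonneg h0, norm_norm]
    exact mul_le_mul_of_nonneg_left (norm_fracCharFun_le hα _) h0
  · filter_upwards [ae_restrict_mem measurableSet_Ioo] with s hs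
    have hp : 0 < (T - s) ^ α := Real.rpow_pos_of_pos (sub_pos.2 hs.2) _
    have h1 : Tendsto (fun n => -l n * (T - s) ^ α) atTop atBot :=
      (tendsto_neg_atTop_atBot.comp hl).atBot_mul_const hp
    have h2 := hφ.comp (h1.mono_right atBot_le_cocompact)
    simpa using h2.norm.const_mul ((T - s) ^ (α - 1))

end Averaging

theorem mainTheorem3 {Ω : Type*} [MeasurableSpace Ω] (P : Measure Ω) [IsProbabilityMeasure P]
    (ξ : Ω → ℝ) (hξ : Measurable ξ)
    (α : ℝ) (hα : α ∈ Ioo (0 : ℝ) 1)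
    (hφ : Tendsto (fracCharFun P ξ α α) (cocompact ℝ) (𝓝 0))
    {d : ℕ} (hd : 1 ≤ d)
    (G : Set (EuclideanSpace ℝ (Fin d))) (hG : IsOpen G) (hGb : Bornology.IsBounded G)
    (G₀ : Set (EuclideanSpace ℝ (Fin d))) (hG₀ : NullMeasurableSet G₀ volume) (hG₀G : G₀ ⊆ G)
    (hG₀pos : 0 < volume G₀)
    (T : ℝ) (hT : 0 < T) :
    ¬ IsExactlyAveragedControllable P ξ α T G G₀ := by
  rintro ⟨C, hC, hctrl⟩
  have hGne : G.Nonempty := (nonempty_of_measure_ne_zero hG₀pos.ne').mono hG₀G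
  have hGfin : volume G ≠ ⊤ := hGb.measure_lt_top.ne
  choose l v hl hv hv1 heig using fun n : ℕ =>
    H10.exists_large_eigenvalue hd hG hGb hGne (Nat.cast_nonneg (α := ℝ) n)
  have hlim := (tendsto_integral_fracCharFun hξ hα hφ hT.le
    (tendsto_atTop_mono hl tendsto_natCast_atTop_atTop)).mul_const (C * √(volume.real G))
  rw [zero_mul] at hlim
  refine absurd (ge_of_tendsto' hlim fun n => ?_) (not_le.2 one_pos)
  obtain ⟨u, hu, y, hy, hyint, hymean⟩ := hctrl 0 (v n).fst
  rw [norm_zero, zero_add, hv1, mul_one] at hu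
  obtain ⟨b, hb, hM, hub⟩ :=
    exists_measurable_bounded_control_component hGfin hG₀ hG₀G u (v n).fst
  have hbC : ∀ s, ‖b s‖ ≤ C * √(volume.real G) := fun s => (hM s).trans <| by
    rw [hv1, mul_one]
    gcongr
  have h1 : (1 : ℂ) = ∫ s in (0 : ℝ)..T, (((T - s) ^ (α - 1) : ℝ) : ℂ) *
      fracCharFun P ξ α α (-l n * (T - s) ^ α) * b s := by
    calc (1 : ℂ) = inner ℂ (v n).fst (v n).fst := by
          rw [inner_self_eq_norm_sq_to_K, hv1]
          simp
      _ = ∫ ω, inner ℂ (v n).fst (y ω T) ∂P := by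
          rw [integral_inner hyint, hymean]
      _ = _ := by
          rw [← integral_integral_mittagLeffler hξ hα hT.le (l n) hb hbC]
          refine integral_congr_ae (hy.mono fun ω hω => ?_)
          exact hω.inner_eq_integral hα hT (hv n) (heig n) hb hbC hub
  calc (1 : ℝ) = ‖(1 : ℂ)‖ := norm_one.symm
    _ ≤ ∫ s in (0 : ℝ)..T, (T - s) ^ (α - 1) * ‖fracCharFun P ξ α α (-l n * (T - s) ^ α)‖ *
        (C * √(volume.real G)) := by
        rw [h1]
        refine intervalIntegral.norm_integral_le_of_norm_le hT.le (ae_of_all _ fun s hs => ?_) ?_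
        · rw [norm_mul, norm_mul, Complex.norm_real,
            Real.norm_of_nonneg (Real.rpow_nonneg (sub_nonneg.2 hs.2) _)]
          exact mul_le_mul_of_nonneg_left (hbC s)
            (mul_nonneg (Real.rpow_nonneg (sub_nonneg.2 hs.2) _) (norm_nonneg _))
        · rw [intervalIntegrable_iff_integrableOn_Ioc_of_le hT.le]
          refine Integrable.mul_const ?_ _
          refine (integrableOn_rpow_sub hα.1 hT.le).integrable.mul_bdd (c := (Real.Gamma α)⁻¹) ?_ ?_
          · refine Measurable.aestronglyMeasurable (Measurable.norm ?_)
            exact (measurable_fracCharFun hξ hα.1).comp (by fun_prop)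
          · exact ae_of_all _ fun s => by
              rw [norm_norm]
              exact norm_fracCharFun_le hα _
    _ = _ := by rw [intervalIntegral.integral_mul_const]
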